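/- For positive integers $n,d$ let $P_{n,d}$ be the graph with vertex set $\{0,1,\dots,n\}$ in which $i$ and $j$ are adjacent if and only if $|i-j|\in\{1,3,\dots,2d+1\}$. Let $\mathrm{Hom}(P_{n,d},0)$ be the finite nonempty set of functions $f:\{0,\dots,n\}\to\mathbb{Z}$ with $f(0)=0$ and $|f(i)-f(j)|=1$ for all adjacent $i,j$. Let $f_{n,d}$ be a uniformly random element of $\mathrm{Hom}(P_{n,d},0)$, and write $\mathrm{Rng}(f)=\{f(v): 0\le v\le n\}$. There exist absolute constants $C,c>0$ such that for all positive integers $n$ and $d$, $$3+\big\lfloor c\sqrt{n2^{-d}}\big\rfloor-2^{1-n/2}\;\le\;\mathbb{E}\big[|\mathrm{Rng}(f_{n,d})|\big]\;\le\;3+C\sqrt{n2^{-d}}.$$ Moreover, for every $\epsilon>0$ there exists $\delta>0$ such that for all positive integers $n$ and $d$, $$\mathbb{P}\Big(|\mathrm{Rng}(f_{n,d})|<3+\big\lfloor\delta\sqrt{n2^{-d}}\big\rfloor\Big)\le\epsilon+2^{1-n/2}.$$ In particular, if $(d(n))_{n\ge1}$ is a sequence of positive integers with $d(n)-\log_2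 n\to-\infty$ as $n\to\infty$, then for every positive integer $r$, $$\mathbb{P}\big(|\mathrm{Rng}(f_{n,d(n)})|\le r\big)\longrightarrow 0\qquad\text{as } n\to\infty.$$ -/

import Mathlib

open MeasureTheory ProbabilityTheory Filter Topology

namespace LineHom

/-- `Hom(G, v₀)`: the maps from the vertices of `G` to the integers that vanish at `v₀`
and change by exactly one along every edge. -/
def Hom {V : Type*} (G : SimpleGraph V) (v₀ : V) : Set (V → ℤ) :=
  {f | f v₀ = 0 ∧ ∀ x y, G.Adj x y → |f x - f y| = 1}

/-- The graph `P_{n,d}` on `{0, 1, …, n}`: two vertices are adjacent when their distance is one of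
`1, 3, …, 2d+1`. -/
def lineGraph (n d : ℕ) : SimpleGraph (Fin (n + 1)) where
  Adj i j := ∃ k : ℕ, k ≤ d ∧ |((i : ℕ) : ℤ) - ((j : ℕ) : ℤ)| = 2 * k + 1
  symm := ⟨by
    rintro i j ⟨k, hk, h⟩
    exact ⟨k, hk, by rw [abs_sub_comm]; exact h⟩⟩
  loopless := ⟨by
    rintro i ⟨k, _, h⟩
    simp only [sub_self, abs_zero] at h
    omega⟩

/-- The law of `f_{n,d}`: the uniform probability measure on the finite nonempty set
`Hom(P_{n,d}, 0)`. -/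
noncomputable def lineLaw (n d : ℕ) : Measure (Fin (n + 1) → ℤ) :=
  uniformOn (Hom (lineGraph n d) 0)

/-- The size `|Rng(f)|` of the range `{f(v) | v ∈ V}`. -/
noncomputable def rangeSize {V : Type*} (f : V → ℤ) : ℕ := (Set.range f).ncard

theorem hom_lineGraph_finite (n d : ℕ) : (Hom (lineGraph n d) 0).Finite := by
  refine (Set.Finite.pi' (fun _ : Fin (n + 1) => Set.finite_Icc (-(n : ℤ)) (n : ℤ))).subset ?_
  rintro f ⟨h0, h1⟩
  have key : ∀ (m : ℕ) (hm : m < n + 1), |f ⟨m, hm⟩| ≤ (m : ℤ) := by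
    intro m
    induction m with
    | zero =>
      intro hm
      have h2 : f ⟨0, hm⟩ = 0 := h0
      rw [h2]; simp
    | succ m ih =>
      intro hm
      have h2 := ih (by omega)
      have h3 := h1 ⟨m + 1, hm⟩ ⟨m, by omega⟩ ⟨0, Nat.zero_le _, by simp⟩
      rw [abs_le] at h2 ⊢
      have h4 := abs_le.mp h3.le
      push_cast
      constructor <;> linarith [h2.1, h2.2, h4.1, h4.2]
  intro i
  have h5 := abs_le.mp (key i.1 i.2)
  have h6 : (i.1 : ℤ) ≤ n := by exact_mod_cast Nat.lt_succ_iff.mp i.2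
  exact ⟨by have := h5.1; simp only [Fin.eta] at this; linarith,
    by have := h5.2; simp only [Fin.eta] at this; linarith⟩

theorem hom_lineGraph_nonempty (n d : ℕ) : (Hom (lineGraph n d) 0).Nonempty := by
  refine ⟨fun i => ((i : ℕ) : ℤ) % 2, by simp, ?_⟩
  rintro x y ⟨k, _, h⟩
  show |((x : ℕ) : ℤ) % 2 - ((y : ℕ) : ℤ) % 2| = 1
  rcases abs_cases (((x : ℕ) : ℤ) - ((y : ℕ) : ℤ)) with ⟨h1, _⟩ | ⟨h1, _⟩ <;>
  rcases abs_cases (((x : ℕ) : ℤ) % 2 - ((y : ℕ) : ℤ) % 2) with ⟨h2, _⟩ | ⟨h2, _⟩ <;> omega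

instance isProbabilityMeasure_lineLaw (n d : ℕ) : IsProbabilityMeasure (lineLaw n d) :=
  isProbabilityMeasure_uniformOn (hom_lineGraph_finite n d) (hom_lineGraph_nonempty n d)

theorem rangeSize_le (n : ℕ) (f : Fin (n + 1) → ℤ) : rangeSize f ≤ n + 1 := by
  have h := Set.ncard_image_le (f := f) (s := Set.univ) Set.finite_univ
  rw [Set.image_univ] at h
  simpa [rangeSize, Set.ncard_univ] using h

theorem integrable_rangeSize (n d : ℕ) :
    Integrable (fun f : Fin (n + 1) → ℤ => (rangeSize f : ℝ)) (lineLaw n d) := by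
  refine Integrable.of_bound (C := (n : ℝ) + 1) ?_ (Eventually.of_forall fun f => ?_)
  · exact (Measurable.of_discrete).aestronglyMeasurable
  · rw [Real.norm_of_nonneg (by positivity)]
    exact_mod_cast rangeSize_le n f

end LineHom

/-!
Along a homomorphism `f` of `P_{n,d}` each new value `f (m + 2)` is either `f m` or the reflection
`2 * f (m + 1) - f m`, a *flip*. A sequence of choices is a homomorphism exactly when two flips at
odd distance are at least `2 * d + 1` apart (`mem_paths`), so only the time since the last flip
matters. The gaps between flips then behave like a renewal process: a gap `g` has weight
`lam ^ (-g)`, where `lam ^ 2 = 2 + ε` and `ε = lam ^ (1 - 2 * d)` is of order `2 ^ (-d)`. A flip at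
even distance from its predecessor undoes it, whereas a flip at odd distance moves the path one unit
further in the same direction. Hence the path is a persistent random walk that makes about
`n * 2 ^ (-d)` moves.

All estimates come from potentials, that is, functionals of a path whose sum over the one-step
extensions is at most a known factor times the previous value (`pot`, `pot_succ`, `sum_paths_le`).
* With unit weights the potential is an exact eigenvector for the factor `lam`, which gives the
  number of homomorphisms up to a constant (`IsRate.two_mul_pow_le_card`).
* A cosine weight shows that staying in `[-R, R]` costs a factor
  `exp (-c * n * 2 ^ (-d) / R ^ 2)` (`IsRate.card_confined_le`). This gives the lower bounds, since
  a small range means confinement.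
* A hyperbolic cosine weight shows that a value `v` is visited with probability at most
  `C * exp (-|v| / √(n * 2 ^ (-d)))` when `n * 2 ^ (-d) ≥ 1` (`IsRate.card_hit_le`). Summing over
  `v` bounds the mean range.
* A path takes a value beyond the third only at a flip at odd distance from its predecessor, and
  the mean number of these is at most a multiple of `n * 2 ^ (-d)` (`sum_card_visits_le`). This
  bounds the mean range when `n * 2 ^ (-d) ≤ 1`.

The correction `2 ^ (1 - n / 2)` bounds the probability of the two homomorphisms without any flip.
-/

namespace LineHom

/-! ### Step-by-step generation of the homomorphisms -/

/-- Stage `m` concerns the values `f 0, …, f (m + 1)`. A step `f (m + 2) ≠ f m` is called a *flip*,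
and `age d f m` is the time elapsed since the last flip. If there has been none it exceeds `2 * d`,
as though a flip had occurred long before the start. -/
def age (d : ℕ) (f : ℕ → ℤ) : ℕ → ℕ
  | 0 => 2 * d + 1
  | m + 1 => if f (m + 2) = f m then age d f m + 1 else 0

/-- A flip is possible when the last flip is at even distance from it, or at distance at least
`2 * d + 1`. -/
abbrev CanFlip (d k : ℕ) : Prop := k % 2 = 1 ∨ 2 * d ≤ k

/-- The extension of `f` by one value without a flip. -/
def keep (m : ℕ) (f : ℕ → ℤ) : ℕ → ℤ := Function.update f (m + 2) (f m)

/-- The extension of `f` by one value with a flip. -/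
def flip (m : ℕ) (f : ℕ → ℤ) : ℕ → ℤ := Function.update f (m + 2) (2 * f (m + 1) - f m)

/-- The function that takes the value `s` at `1` and vanishes elsewhere. -/
def start (s : ℤ) : ℕ → ℤ := Function.update (fun _ => 0) 1 s

@[simp] theorem start_zero (s : ℤ) : start s 0 = 0 := Function.update_of_ne (by omega) _ _

@[simp] theorem start_one (s : ℤ) : start s 1 = s := Function.update_self ..

theorem start_of_lt (s : ℤ) {i : ℕ} (hi : 1 < i) : start s i = 0 :=
  Function.update_of_ne (by omega) _ _

open Classical in
/-- The homomorphisms on `{0, …, m + 1}`, continued by zero, generated one value at a time. -/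
noncomputable def paths (d : ℕ) : ℕ → Finset (ℕ → ℤ)
  | 0 => {start 1, start (-1)}
  | m + 1 => (paths d m).image (keep m) ∪
      ((paths d m).filter fun f => CanFlip d (age d f m)).image (flip m)

/-- The homomorphism condition for `f` on `{0, …, m + 1}`, with `f` continued by zero. -/
structure IsPath (d m : ℕ) (f : ℕ → ℤ) : Prop where
  zero : f 0 = 0
  beyond : ∀ i, m + 1 < i → f i = 0
  hom : ∀ i j, i < j → j ≤ m + 1 → (j - i) % 2 = 1 → j - i ≤ 2 * d + 1 → |f j - f i| = 1

/-- What the age remembers: the class of positions of the last flip is constant since that flip,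
the other class is constant since `2 * d + 1` steps before it, and the flip itself is visible when
it is recent. -/
structure Tracked (d m : ℕ) (f : ℕ → ℤ) : Prop where
  same : ∀ i ≤ m + 1, (m + 1 - i) % 2 = 0 →
    (m + 1 ≤ i + age d f m ∨ (age d f m % 2 = 1 ∧ m + 1 ≤ i + age d f m + 1 + 2 * d)) →
    f i = f (m + 1)
  other : ∀ i ≤ m + 1, (m + 1 - i) % 2 = 1 →
    (m + 1 ≤ i + age d f m ∨ (age d f m % 2 = 0 ∧ m + 1 ≤ i + age d f m + 1 + 2 * d)) →
    f i = f m
  last : age d f m < 2 * d → age d f m + 2 ≤ m + 1 ∧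
    f (m + 1 - age d f m - 2) =
      if age d f m % 2 = 0 then 2 * f m - f (m + 1) else 2 * f (m + 1) - f m

theorem age_congr {d m : ℕ} {f g : ℕ → ℤ} (h : ∀ i ≤ m + 1, f i = g i) :
    age d f m = age d g m := by
  induction m with
  | zero => rfl
  | succ m ih =>
    simp only [age]
    rw [ih fun i hi => h i (by omega), h (m + 2) (by omega), h m (by omega)]

theorem keep_of_le {m i : ℕ} (f : ℕ → ℤ) (hi : i ≤ m + 1) : keep m f i = f i :=
  Function.update_of_ne (by omega) _ _

theorem flip_of_le {m i : ℕ} (f : ℕ → ℤ) (hi : i ≤ m + 1) : flip m f i = f i :=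
  Function.update_of_ne (by omega) _ _

@[simp] theorem keep_new (m : ℕ) (f : ℕ → ℤ) : keep m f (m + 2) = f m :=
  Function.update_self ..

@[simp] theorem flip_new (m : ℕ) (f : ℕ → ℤ) : flip m f (m + 2) = 2 * f (m + 1) - f m :=
  Function.update_self ..

@[simp] theorem keep_last (m : ℕ) (f : ℕ → ℤ) : keep m f (m + 1) = f (m + 1) :=
  keep_of_le f le_rfl

@[simp] theorem flip_last (m : ℕ) (f : ℕ → ℤ) : flip m f (m + 1) = f (m + 1) :=
  flip_of_le f le_rfl

theorem age_keep (d m : ℕ) (f : ℕ → ℤ) : age d (keep m f) (m + 1) = age d f m + 1 := by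
  rw [age, if_pos (by rw [keep_new, keep_of_le f (by omega)]),
    age_congr fun i hi => keep_of_le f hi]

theorem age_flip (d m : ℕ) {f : ℕ → ℤ} (h : f (m + 1) ≠ f m) : age d (flip m f) (m + 1) = 0 := by
  rw [age, if_neg]
  rw [flip_new, flip_of_le f (by omega)]
  omega

theorem IsPath.step {d m : ℕ} {f : ℕ → ℤ} (h : IsPath d m f) : |f (m + 1) - f m| = 1 :=
  h.hom m (m + 1) (by omega) le_rfl (by omega) (by omega)

theorem IsPath.ne {d m : ℕ} {f : ℕ → ℤ} (h : IsPath d m f) : f (m + 1) ≠ f m := by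
  intro h1
  have := h.step
  simp [h1] at this

theorem Tracked.eq_last {d m : ℕ} {f : ℕ → ℤ} (h : Tracked d m f) (hc : CanFlip d (age d f m))
    {i : ℕ} (hi : i ≤ m + 1) (h2 : (m + 1 - i) % 2 = 0) (h3 : m + 1 ≤ i + 2 * d) :
    f i = f (m + 1) :=
  h.same i hi h2 (by rcases hc with hc | hc <;> omega)

theorem IsPath.keep {d m : ℕ} {f : ℕ → ℤ} (h : IsPath d m f) : IsPath d (m + 1) (keep m f) where
  zero := by rw [keep_of_le f (by omega), h.zero]
  beyond i hi := by
    rw [LineHom.keep, Function.update_of_ne (by omega), h.beyond i (by omega)]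
  hom i j hij hj h2 hd := by
    rcases Nat.lt_or_ge j (m + 2) with h3 | h3
    · rw [keep_of_le f (by omega), keep_of_le f (by omega)]
      exact h.hom i j hij (by omega) h2 hd
    · obtain rfl : j = m + 2 := by omega
      rw [keep_new, keep_of_le f (by omega)]
      rcases Nat.lt_or_ge i m with h4 | h4
      · exact h.hom i m h4 (by omega) (by omega) (by omega)
      · obtain rfl : i = m + 1 := by omega
        rw [abs_sub_comm]; exact h.step

theorem IsPath.flip {d m : ℕ} {f : ℕ → ℤ} (h : IsPath d m f) (ht : Tracked d m f)
    (hc : CanFlip d (age d f m)) : IsPath d (m + 1) (flip m f) where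
  zero := by rw [flip_of_le f (by omega), h.zero]
  beyond i hi := by
    rw [LineHom.flip, Function.update_of_ne (by omega), h.beyond i (by omega)]
  hom i j hij hj h2 hd := by
    rcases Nat.lt_or_ge j (m + 2) with h3 | h3
    · rw [flip_of_le f (by omega), flip_of_le f (by omega)]
      exact h.hom i j hij (by omega) h2 hd
    · obtain rfl : j = m + 2 := by omega
      rw [flip_new, flip_of_le f (by omega), ht.eq_last hc (i := i) (by omega) (by omega) (by omega)]
      have := h.step
      rwa [show 2 * f (m + 1) - f m - f (m + 1) = f (m + 1) - f m by ring]

theorem Tracked.keep {d m : ℕ} {f : ℕ → ℤ} (h : Tracked d m f) :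
    Tracked d (m + 1) (keep m f) where
  same i hi h2 h3 := by
    rw [age_keep] at h3
    show _ = LineHom.keep m f (m + 2)
    rcases Nat.lt_or_ge i (m + 2) with h4 | h4
    · rw [keep_new, keep_of_le f (by omega)]
      exact h.other i (by omega) (by omega) (by omega)
    · obtain rfl : i = m + 2 := by omega
      rfl
  other i hi h2 h3 := by
    rw [age_keep] at h3
    rw [keep_last, keep_of_le f (by omega)]
    exact h.same i (by omega) (by omega) (by omega)
  last h1 := by
    rw [age_keep] at h1 ⊢
    obtain ⟨h2, h3⟩ := h.last (by omega)
    refine ⟨by omega, ?_⟩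
    rw [show m + 1 + 1 - (age d f m + 1) - 2 = m + 1 - age d f m - 2 by omega,
      keep_of_le f (by omega), h3]
    show _ = if _ then 2 * LineHom.keep m f (m + 1) - LineHom.keep m f (m + 2)
      else 2 * LineHom.keep m f (m + 2) - LineHom.keep m f (m + 1)
    rw [keep_last, keep_new]
    split_ifs <;> first | rfl | omega

theorem Tracked.flip {d m : ℕ} {f : ℕ → ℤ} (h : Tracked d m f) (hne : f (m + 1) ≠ f m)
    (hc : CanFlip d (age d f m)) : Tracked d (m + 1) (flip m f) where
  same i hi h2 h3 := by
    rw [age_flip d m hne] at h3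
    obtain rfl : i = m + 2 := by omega
    rfl
  other i hi h2 h3 := by
    rw [age_flip d m hne] at h3
    rw [flip_last, flip_of_le f (by omega)]
    exact h.eq_last hc (by omega) (by omega) (by omega)
  last _ := by
    rw [age_flip d m hne]
    refine ⟨by omega, ?_⟩
    rw [if_pos rfl]
    show LineHom.flip m f m = 2 * LineHom.flip m f (m + 1) - LineHom.flip m f (m + 2)
    rw [flip_new, flip_last, flip_of_le f (by omega)]
    ring

theorem isPath_tracked_of_mem {d m : ℕ} {f : ℕ → ℤ} (hf : f ∈ paths d m) :
    IsPath d m f ∧ Tracked d m f := by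
  induction m generalizing f with
  | zero =>
    have key : ∀ s : ℤ, |s| = 1 → IsPath d 0 (start s) ∧
        Tracked d 0 (start s) := by
      intro s hs
      refine ⟨⟨by simp, fun i hi => ?_, fun i j hij hj _ _ => ?_⟩,
        ⟨fun i hi h2 _ => ?_, fun i hi h2 _ => ?_, fun h => ?_⟩⟩
      · exact start_of_lt s (by omega)
      · obtain rfl : i = 0 := by omega
        obtain rfl : j = 1 := by omega
        simpa using hs
      · obtain rfl : i = 1 := by omega
        rfl
      · obtain rfl : i = 0 := by omega
        rfl
      · simp only [age] at h; omega
    simp only [paths, Finset.mem_insert, Finset.mem_singleton] at hf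
    rcases hf with rfl | rfl
    · exact key 1 (by norm_num)
    · exact key (-1) (by norm_num)
  | succ m ih =>
    simp only [paths, Finset.mem_union, Finset.mem_image, Finset.mem_filter] at hf
    rcases hf with ⟨g, hg, rfl⟩ | ⟨g, ⟨hg, hc⟩, rfl⟩
    · exact ⟨(ih hg).1.keep, (ih hg).2.keep⟩
    · exact ⟨(ih hg).1.flip (ih hg).2 hc, (ih hg).2.flip (ih hg).1.ne hc⟩

theorem mem_paths_of_isPath {d m : ℕ} {f : ℕ → ℤ} (hf : IsPath d m f) : f ∈ paths d m := by
  induction m generalizing f with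
  | zero =>
    have h1 := hf.step
    have h0 := hf.zero
    simp only [zero_add, h0, sub_zero] at h1
    have key : ∀ s : ℤ, f 1 = s → f = start s := by
      intro s hs
      funext i
      rcases Nat.lt_trichotomy i 1 with h | h | h
      · obtain rfl : i = 0 := by omega
        simpa using h0
      · subst h; simpa using hs
      · rw [start_of_lt s h]; exact hf.beyond i h
    simp only [paths, Finset.mem_insert, Finset.mem_singleton]
    rcases (abs_eq (by norm_num)).1 h1 with h2 | h2
    · exact Or.inl (key _ h2)
    · exact Or.inr (key _ h2)
  | succ m ih =>
    set g := Function.update f (m + 2) 0 with hgdef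
    have hg_of : ∀ i ≤ m + 1, g i = f i := fun i hi => Function.update_of_ne (by omega) _ _
    have hg : IsPath d m g := by
      refine ⟨by rw [hg_of 0 (by omega), hf.zero], fun i hi => ?_, fun i j hij hj h2 hd => ?_⟩
      · rcases Nat.lt_or_ge (m + 2) i with h | h
        · rw [hgdef, Function.update_of_ne (by omega), hf.beyond i h]
        · obtain rfl : i = m + 2 := by omega
          simp [hgdef]
      · rw [hg_of i (by omega), hg_of j hj]
        exact hf.hom i j hij (by omega) h2 hd
    have hmem := ih hg
    have ht := (isPath_tracked_of_mem hmem).2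
    have hfu : ∀ v, f (m + 2) = v → Function.update g (m + 2) v = f := by
      rintro v rfl; simp [hgdef]
    have h1 := hf.hom (m + 1) (m + 2) (by omega) le_rfl (by omega) (by omega)
    have h2 := hf.hom m (m + 1) (by omega) (by omega) (by omega) (by omega)
    simp only [paths, Finset.mem_union, Finset.mem_image, Finset.mem_filter]
    by_cases h3 : f (m + 2) = f m
    · exact Or.inl ⟨g, hmem, hfu _ (by rw [hg_of m (by omega), h3])⟩
    · have h4 : f (m + 2) = 2 * f (m + 1) - f m := by
        rcases (abs_eq (by norm_num)).1 h1 with h5 | h5 <;>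
        rcases (abs_eq (by norm_num)).1 h2 with h6 | h6 <;> omega
      refine Or.inr ⟨g, ⟨hmem, ?_⟩, hfu _ (by rw [hg_of m (by omega), hg_of _ le_rfl, h4])⟩
      by_contra hc
      rw [CanFlip, not_or, not_le] at hc
      obtain ⟨h5, h6⟩ := ht.last hc.2
      rw [if_pos (by omega), hg_of _ (by omega), hg_of _ (by omega), hg_of _ le_rfl] at h6
      -- the values before the last flip and after the new one would differ by three
      have h7 := hf.hom (m + 1 - age d g m - 2) (m + 2) (by omega) le_rfl (by omega) (by omega)
      rw [h4, h6] at h7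
      rcases (abs_eq (by norm_num)).1 h7 with h8 | h8 <;>
      rcases (abs_eq (by norm_num)).1 h2 with h9 | h9 <;> omega

theorem mem_paths {d m : ℕ} {f : ℕ → ℤ} : f ∈ paths d m ↔ IsPath d m f :=
  ⟨fun h => (isPath_tracked_of_mem h).1, mem_paths_of_isPath⟩

theorem eq_of_agree {d m : ℕ} {f g : ℕ → ℤ} (hf : IsPath d m f) (hg : IsPath d m g)
    (h : ∀ i ≤ m + 1, f i = g i) : f = g := by
  funext i
  rcases Nat.lt_or_ge (m + 1) i with h1 | h1
  · rw [hf.beyond i h1, hg.beyond i h1]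
  · exact h i h1

/-- Summation over the homomorphisms, organised by the last value. -/
theorem sum_paths_succ (d m : ℕ) (Ψ : (ℕ → ℤ) → ℝ) :
    ∑ f ∈ paths d (m + 1), Ψ f =
      ∑ f ∈ paths d m, (Ψ (keep m f) + if CanFlip d (age d f m) then Ψ (flip m f) else 0) := by
  classical
  rw [paths, Finset.sum_union, Finset.sum_image, Finset.sum_image, Finset.sum_filter,
    ← Finset.sum_add_distrib]
  · intro f hf g hg h
    simp only [Finset.coe_filter, Set.mem_ofPred_eq, mem_paths] at hf hg
    exact eq_of_agree hf.1 hg.1 fun i hi => by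
      rw [← flip_of_le f hi, ← flip_of_le g hi, h]
  · intro f hf g hg h
    simp only [Finset.mem_coe, mem_paths] at hf hg
    exact eq_of_agree hf hg fun i hi => by
      rw [← keep_of_le f hi, ← keep_of_le g hi, h]
  · rw [Finset.disjoint_left]
    intro e h1 h2
    simp only [Finset.mem_image, Finset.mem_filter, mem_paths] at h1 h2
    obtain ⟨f, hf, rfl⟩ := h1
    obtain ⟨g, ⟨hg, -⟩, h⟩ := h2
    have hfg : g = f := eq_of_agree hg hf fun i hi => by
      rw [← keep_of_le f hi, ← flip_of_le g hi, h]
    subst hfg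
    have h3 := congrFun h (m + 2)
    rw [keep_new, flip_new] at h3
    have := hf.ne
    omega

theorem sum_paths_zero (d : ℕ) (Ψ : (ℕ → ℤ) → ℝ) :
    ∑ f ∈ paths d 0, Ψ f = Ψ (start 1) + Ψ (start (-1)) := by
  classical
  rw [paths, Finset.sum_pair]
  intro h
  have := congrFun h 1
  simp at this

/-- A functional whose sum over the one-step extensions is at most `A` times its value grows at
most like `A ^ m` in total. -/
theorem sum_paths_le {d : ℕ} {A : ℝ} (hA : 0 ≤ A) (Ψ : ℕ → (ℕ → ℤ) → ℝ)
    (h : ∀ m, ∀ f ∈ paths d m, (Ψ (m + 1) (keep m f) +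
      if CanFlip d (age d f m) then Ψ (m + 1) (flip m f) else 0) ≤ A * Ψ m f) (m : ℕ) :
    ∑ f ∈ paths d m, Ψ m f ≤
      A ^ m * (Ψ 0 (start 1) + Ψ 0 (start (-1))) := by
  induction m with
  | zero => rw [sum_paths_zero]; simp
  | succ m ih =>
    rw [sum_paths_succ]
    calc _ ≤ ∑ f ∈ paths d m, A * Ψ m f := Finset.sum_le_sum (h m)
      _ = A * ∑ f ∈ paths d m, Ψ m f := by rw [Finset.mul_sum]
      _ ≤ _ := by rw [pow_succ', mul_assoc]; exact mul_le_mul_of_nonneg_left ih hA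

/-- The set of values taken on `{0, …, m + 1}`. -/
def visits (m : ℕ) (f : ℕ → ℤ) : Finset ℤ := (Finset.range (m + 2)).image f

theorem mem_visits {m : ℕ} {f : ℕ → ℤ} {v : ℤ} : v ∈ visits m f ↔ ∃ i ≤ m + 1, f i = v := by
  simp only [visits, Finset.mem_image, Finset.mem_range]
  exact ⟨fun ⟨i, hi, h⟩ => ⟨i, by omega, h⟩, fun ⟨i, hi, h⟩ => ⟨i, by omega, h⟩⟩

theorem apply_mem_visits {m i : ℕ} (f : ℕ → ℤ) (hi : i ≤ m + 1) : f i ∈ visits m f :=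
  mem_visits.2 ⟨i, hi, rfl⟩

theorem visits_succ {m : ℕ} {f g : ℕ → ℤ} (h : ∀ i ≤ m + 1, g i = f i) :
    visits (m + 1) g = insert (g (m + 2)) (visits m f) := by
  rw [visits, Finset.range_add_one, Finset.image_insert, visits]
  congr 1
  exact Finset.image_congr fun i hi => h i (by simp at hi; omega)

theorem visits_keep (m : ℕ) (f : ℕ → ℤ) : visits (m + 1) (keep m f) = visits m f := by
  rw [visits_succ fun i hi => keep_of_le f hi, keep_new]
  exact Finset.insert_eq_of_mem (apply_mem_visits f (by omega))

theorem visits_flip (m : ℕ) (f : ℕ → ℤ) :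
    visits (m + 1) (flip m f) = insert (2 * f (m + 1) - f m) (visits m f) := by
  rw [visits_succ fun i hi => flip_of_le f hi, flip_new]

theorem visits_zero (s : ℤ) : visits 0 (start s) = {s, 0} := by
  simp [visits, Finset.range_add_one]

/-! ### Potentials -/

/-- The number `A ^ (1 - 2 * d)`, which is `A ^ 2 - 1` times the sum of `A⁻ᵍ` over the odd gaps
`g ≥ 2 * d + 1` between consecutive flips. -/
noncomputable def decay (d : ℕ) (A : ℝ) : ℝ := A * ((A ^ 2)⁻¹) ^ d

/-- The potential of a path of age `k`. The numbers `p` and `q` are the weights of the states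
reached when the next flip comes after an odd, respectively even, number of steps, and
`pot d A k p q` is `A ^ 2 - 1` times the sum of these weights, discounted by `A⁻¹` per step, over
all possible positions of the next flip. -/
noncomputable def pot (d : ℕ) (A : ℝ) (k : ℕ) (p q : ℝ) : ℝ :=
  if k % 2 = 0 then q + A * ((A ^ 2)⁻¹) ^ (d - k / 2) * p
  else A * p + ((A ^ 2)⁻¹) ^ (d - (k + 1) / 2) * q

theorem pot_zero (d : ℕ) (A p q : ℝ) : pot d A 0 p q = q + decay d A * p := by
  simp [pot, decay]

theorem pot_start (d : ℕ) (A p q : ℝ) : pot d A (2 * d + 1) p q = A * p + q := by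
  rw [pot, if_neg (by omega), show d - (2 * d + 1 + 1) / 2 = 0 by omega]
  simp

/-- Keeping exchanges the two weights; a flip, where possible, is worth `(A ^ 2 - 1) * p`. -/
theorem pot_succ (d : ℕ) {A : ℝ} (hA : 0 < A) (k : ℕ) (p q : ℝ) :
    A * pot d A k p q =
      pot d A (k + 1) q p + if CanFlip d k then (A ^ 2 - 1) * p else 0 := by
  rcases Nat.mod_two_eq_zero_or_one k with hk | hk
  · rw [pot, pot, if_pos hk, if_neg (by omega)]
    by_cases hd : 2 * d ≤ k
    · rw [if_pos (Or.inr hd), show d - k / 2 = 0 by omega, show d - (k + 1 + 1) / 2 = 0 by omega]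
      ring
    · rw [if_neg (by simp [CanFlip, hk, hd]),
        show d - k / 2 = d - (k + 1 + 1) / 2 + 1 by omega, pow_succ]
      field_simp
      ring
  · rw [pot, pot, if_neg (by omega), if_pos (by omega), if_pos (Or.inl hk)]
    ring

theorem le_pot_of_le {d k : ℕ} {A p q c : ℝ} (hA : 1 ≤ A) (hc : 0 ≤ c) (hp : c ≤ p)
    (hq : c ≤ q) : c ≤ pot d A k p q := by
  have hA0 : 0 ≤ A := by linarith
  have hp0 := hc.trans hp
  have hq0 := hc.trans hq
  rw [pot]
  split_ifs
  · have : 0 ≤ A * ((A ^ 2)⁻¹) ^ (d - k / 2) * p := by positivity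
    linarith
  · have h1 : 0 ≤ ((A ^ 2)⁻¹) ^ (d - (k + 1) / 2) * q := by positivity
    nlinarith

theorem pot_one_le {d k : ℕ} {A : ℝ} (hA : 1 ≤ A) : pot d A k 1 1 ≤ A + 1 := by
  have h1 : (A ^ 2)⁻¹ ≤ 1 := inv_le_one_of_one_le₀ (by nlinarith)
  have h2 : 0 ≤ (A ^ 2)⁻¹ := by positivity
  rw [pot]
  split_ifs
  · have := pow_le_one₀ h2 h1 (n := d - k / 2)
    nlinarith
  · have := pow_le_one₀ h2 h1 (n := d - (k + 1) / 2)
    nlinarith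

/-! ### The growth rate -/

/-- The number of homomorphisms grows like `lam ^ n`, where `lam ^ 2 = 2 + lam ^ (1 - 2 * d)`. -/
structure IsRate (d : ℕ) (lam : ℝ) : Prop where
  one_le : 1 ≤ lam
  le : lam ≤ 7 / 4
  sq : lam ^ 2 = 2 + decay d lam

theorem decay_pos (d : ℕ) {A : ℝ} (hA : 0 < A) : 0 < decay d A := by
  unfold decay; positivity

theorem exists_isRate {d : ℕ} (hd : 1 ≤ d) : ∃ lam, IsRate d lam := by
  have hcont : ContinuousOn (fun A : ℝ => A ^ 2 - 2 - decay d A) (Set.Icc 1 (7 / 4)) := by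
    unfold decay
    refine ((continuousOn_id.pow 2).sub continuousOn_const).sub
      (continuousOn_id.mul (ContinuousOn.pow (ContinuousOn.inv₀ (continuousOn_id.pow 2) ?_) d))
    intro x hx
    have : (1 : ℝ) ≤ x := hx.1
    exact pow_ne_zero 2 (by simp only [id]; linarith)
  have hup : decay d (7 / 4) ≤ 4 / 7 := by
    have : (((7 / 4 : ℝ) ^ 2)⁻¹) ^ d ≤ (((7 / 4 : ℝ) ^ 2)⁻¹) ^ 1 :=
      pow_le_pow_of_le_one (by norm_num) (by norm_num) hd
    rw [decay]
    norm_num at this ⊢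
    linarith
  have h0 : (0 : ℝ) ∈ Set.Icc ((fun A : ℝ => A ^ 2 - 2 - decay d A) 1)
      ((fun A : ℝ => A ^ 2 - 2 - decay d A) (7 / 4)) := by
    constructor
    · have := decay_pos d one_pos
      simp only
      linarith
    · simp only
      norm_num at hup ⊢
      linarith
  obtain ⟨lam, h1, h2⟩ := intermediate_value_Icc (by norm_num) hcont h0
  exact ⟨lam, h1.1, h1.2, by simp only at h2; linarith⟩

namespace IsRate

variable {d : ℕ} {lam : ℝ} (h : IsRate d lam)
include h

theorem pos : 0 < lam := by linarith [h.one_le]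

theorem decay_pos : 0 < decay d lam := LineHom.decay_pos d h.pos

theorem two_le_sq : 2 ≤ lam ^ 2 := by linarith [h.sq, h.decay_pos]

theorem decay_le : decay d lam ≤ 7 / 4 / 2 ^ d := by
  have h1 : ((lam ^ 2)⁻¹) ^ d ≤ (2⁻¹) ^ d :=
    pow_le_pow_left₀ (by positivity) (inv_anti₀ (by norm_num) h.two_le_sq) d
  rw [decay, div_eq_mul_inv, ← inv_pow (2 : ℝ)]
  exact mul_le_mul h.le h1 (by positivity) (by norm_num)

theorem decay_le_one (hd : 1 ≤ d) : decay d lam ≤ 1 := by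
  refine h.decay_le.trans ?_
  rw [div_le_one (by positivity)]
  have : (2 : ℝ) ^ 1 ≤ 2 ^ d := pow_le_pow_right₀ (by norm_num) hd
  linarith

theorem mul_decay_le : (2 * d - 1 : ℝ) * decay d lam ≤ 7 / 4 := by
  have h2 : (2 * d : ℝ) ≤ 2 ^ d + 1 := by
    have : ∀ d : ℕ, 2 * d ≤ 2 ^ d + 1 := by
      intro d
      induction d with
      | zero => simp
      | succ d ih =>
        rcases d with _ | d
        · simp
        · rw [pow_succ]; have := Nat.one_le_two_pow (n := d); rw [pow_succ] at ih ⊢; omega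
    exact_mod_cast this d
  calc (2 * d - 1 : ℝ) * decay d lam ≤ 2 ^ d * decay d lam :=
        mul_le_mul_of_nonneg_right (by linarith) h.decay_pos.le
    _ ≤ 2 ^ d * (7 / 4 / 2 ^ d) := mul_le_mul_of_nonneg_left h.decay_le (by positivity)
    _ = 7 / 4 := by field_simp

theorem le_decay : 1 / 4 / 2 ^ d ≤ decay d lam := by
  -- `lam ^ (2 * d) = 2 ^ d * (1 + decay / 2) ^ d`, and the last factor is bounded
  have h1 : (lam ^ 2) ^ d ≤ 2 ^ d * 4 := by
    rcases Nat.eq_zero_or_pos d with hd | hd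
    · subst hd; norm_num
    have h2 : lam ^ 2 = 2 * (1 + decay d lam / 2) := by rw [h.sq]; ring
    rw [h2, mul_pow]
    refine mul_le_mul_of_nonneg_left ?_ (by positivity)
    have h3 : 1 + decay d lam / 2 ≤ Real.exp (decay d lam / 2) := by
      linarith [Real.add_one_le_exp (decay d lam / 2)]
    calc (1 + decay d lam / 2) ^ d ≤ Real.exp (decay d lam / 2) ^ d :=
          pow_le_pow_left₀ (by linarith [h.decay_pos]) h3 d
      _ = Real.exp (d * (decay d lam / 2)) := by rw [← Real.exp_nat_mul]
      _ ≤ Real.exp 1 := by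
          refine Real.exp_le_exp.2 ?_
          have := h.mul_decay_le
          have hd1 : (1 : ℝ) ≤ d := by exact_mod_cast hd
          nlinarith [h.decay_pos]
      _ ≤ 4 := by linarith [Real.exp_one_lt_d9]
  rw [decay, div_div, one_div, mul_comm (4 : ℝ), inv_pow]
  have h4 : (2 ^ d * 4 : ℝ)⁻¹ ≤ ((lam ^ 2) ^ d)⁻¹ :=
    inv_anti₀ (pow_pos (by linarith [h.two_le_sq]) _) h1
  have h5 : 0 ≤ ((lam ^ 2) ^ d)⁻¹ := by positivity
  nlinarith [h.one_le]

/-- At the growth rate, the potential with unit weights is exactly multiplicative. -/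
theorem pot_one_succ (k : ℕ) :
    lam * pot d lam k 1 1 =
      pot d lam (k + 1) 1 1 + if CanFlip d k then pot d lam 0 1 1 else 0 := by
  rw [pot_succ d h.pos, pot_zero]
  congr 2
  linarith [h.sq]

theorem one_le_pot (k : ℕ) : 1 ≤ pot d lam k 1 1 := le_pot_of_le h.one_le zero_le_one le_rfl le_rfl

theorem sum_pot (m : ℕ) :
    ∑ f ∈ paths d m, pot d lam (age d f m) 1 1 = lam ^ m * (2 * (lam + 1)) := by
  induction m with
  | zero =>
    rw [sum_paths_zero]
    simp only [age, pot_start]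
    ring
  | succ m ih =>
    rw [sum_paths_succ, pow_succ', mul_assoc, ← ih, Finset.mul_sum]
    refine Finset.sum_congr rfl fun f hf => ?_
    rw [h.pot_one_succ, age_keep, age_flip d m (mem_paths.1 hf).ne]

theorem two_mul_pow_le_card (m : ℕ) : 2 * lam ^ m ≤ (paths d m).card := by
  have h1 : ∑ f ∈ paths d m, pot d lam (age d f m) 1 1 ≤ ∑ f ∈ paths d m, (lam + 1) :=
    Finset.sum_le_sum fun f _ => pot_one_le h.one_le
  rw [h.sum_pot, Finset.sum_const, nsmul_eq_mul] at h1
  have h2 := h.pos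
  nlinarith

end IsRate

/-- Counting by a potential that is at least `c` on the event. -/
theorem mul_card_filter_le {d m : ℕ} {c : ℝ} {P : (ℕ → ℤ) → Prop} [DecidablePred P]
    {Ψ : (ℕ → ℤ) → ℝ}
    (h0 : ∀ f ∈ paths d m, 0 ≤ Ψ f) (h : ∀ f ∈ paths d m, P f → c ≤ Ψ f) :
    c * ((paths d m).filter P).card ≤ ∑ f ∈ paths d m, Ψ f := by
  rw [Finset.natCast_card_filter, Finset.mul_sum]
  refine Finset.sum_le_sum fun f hf => ?_
  split_ifs with hP
  · simpa using h f hf hP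
  · simpa using h0 f hf

/-! ### Few homomorphisms take only two values -/

theorem three_le_card_visits_flip {d m : ℕ} {f : ℕ → ℤ} (hf : IsPath d m f) :
    3 ≤ (visits (m + 1) (flip m f)).card := by
  have hne := hf.ne
  have : ({2 * f (m + 1) - f m, f (m + 1), f m} : Finset ℤ) ⊆ visits (m + 1) (flip m f) := by
    rw [visits_flip]
    refine Finset.insert_subset_insert _ ?_
    intro v hv
    simp only [Finset.mem_insert, Finset.mem_singleton] at hv
    rcases hv with rfl | rfl
    · exact apply_mem_visits f le_rfl
    · exact apply_mem_visits f (by omega)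
  refine le_trans (le_of_eq ?_) (Finset.card_le_card this)
  rw [Finset.card_eq_three.2 ⟨_, _, _, ?_, ?_, ?_, rfl⟩] <;> omega

theorem card_two_valued_le (d m : ℕ) :
    (((paths d m).filter fun f => (visits m f).card < 3).card : ℝ) ≤ 2 := by
  have h := sum_paths_le (d := d) zero_le_one
    (fun m f => if (visits m f).card < 3 then (1 : ℝ) else 0) (fun m f hf => ?_) m
  · rw [Finset.natCast_card_filter]
    refine h.trans ?_
    simp only [one_pow, one_mul]
    split_ifs <;> norm_num
  · have h3 := three_le_card_visits_flip (mem_paths.1 hf)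
    simp only [visits_keep]
    rw [if_neg (not_lt.2 h3)]
    simp

/-! ### The mean number of values beyond the third -/

/-- After its first flip a path has an already visited value at the place where the next flip at
even distance from the last one would lead. -/
theorem even_flip_visited {d m : ℕ} {f : ℕ → ℤ} (hf : f ∈ paths d m)
    (h3 : 3 ≤ (visits m f).card) :
    (if age d f m % 2 = 0 then 2 * f m - f (m + 1) else 2 * f (m + 1) - f m) ∈ visits m f := by
  classical
  induction m generalizing f with
  | zero =>
    exfalso
    have : (visits 0 f).card ≤ 2 := by
      unfold visits
      exact Finset.card_image_le.trans (by simp)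
    omega
  | succ m ih =>
    simp only [paths, Finset.mem_union, Finset.mem_image, Finset.mem_filter] at hf
    rcases hf with ⟨g, hg, rfl⟩ | ⟨g, ⟨hg, hc⟩, rfl⟩
    · rw [visits_keep] at h3 ⊢
      rw [age_keep, show m + 1 + 1 = m + 2 from rfl, keep_new, keep_last]
      convert ih hg h3 using 1
      split_ifs <;> first | rfl | omega
    · rw [age_flip d m (mem_paths.1 hg).ne, show m + 1 + 1 = m + 2 from rfl, flip_new, flip_last,
        if_pos rfl, visits_flip]
      refine Finset.mem_insert_of_mem ?_
      rw [show 2 * g (m + 1) - (2 * g (m + 1) - g m) = g m by ring]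
      exact apply_mem_visits g (by omega)

/-- A potential dominating the number of values beyond the third: a flip at odd distance from the
last one is credited with one more value. -/
noncomputable def excess (d : ℕ) (lam : ℝ) (m : ℕ) (f : ℕ → ℤ) : ℝ :=
  if (visits m f).card < 3 then 0
  else if age d f m % 2 = 0 then
    pot d lam (age d f m) ((visits m f).card - 2) ((visits m f).card - 3)
  else pot d lam (age d f m) ((visits m f).card - 3) ((visits m f).card - 2)

theorem excess_keep (d : ℕ) (lam : ℝ) (m : ℕ) (f : ℕ → ℤ) :
    excess d lam (m + 1) (keep m f) =
      if (visits m f).card < 3 then 0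
      else if age d f m % 2 = 0 then
        pot d lam (age d f m + 1) ((visits m f).card - 3) ((visits m f).card - 2)
      else pot d lam (age d f m + 1) ((visits m f).card - 2) ((visits m f).card - 3) := by
  rw [excess, visits_keep, age_keep]
  split_ifs <;> first | rfl | omega

theorem excess_step {d : ℕ} {lam : ℝ} (h : IsRate d lam) (m : ℕ) {f : ℕ → ℤ}
    (hf : f ∈ paths d m) :
    (excess d lam (m + 1) (keep m f) +
      if CanFlip d (age d f m) then excess d lam (m + 1) (flip m f) else 0) ≤
    lam * excess d lam m f + decay d lam := by
  have hp := mem_paths.1 hf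
  have h3 := three_le_card_visits_flip hp
  have hflip : excess d lam (m + 1) (flip m f) =
      (lam ^ 2 - 1) * ((visits (m + 1) (flip m f)).card - 3) + decay d lam := by
    rw [excess, if_neg (not_lt.2 h3), age_flip d m hp.ne, if_pos rfl, pot_zero, h.sq]
    ring
  have hsq := h.two_le_sq
  have hdec := h.decay_pos
  have hcard : (visits (m + 1) (flip m f)).card ≤ (visits m f).card + 1 := by
    rw [visits_flip]; exact Finset.card_insert_le _ _
  rw [excess_keep, hflip, excess]
  split_ifs with h1 h2 h4 h5 h6
  · have : ((visits (m + 1) (flip m f)).card : ℝ) ≤ 3 := by exact_mod_cast (by omega)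
    nlinarith
  · simp [hdec.le]
  · rw [pot_succ d h.pos, if_pos h5]
    have : ((visits (m + 1) (flip m f)).card : ℝ) ≤ (visits m f).card + 1 := by
      exact_mod_cast hcard
    nlinarith
  · rw [pot_succ d h.pos, if_neg h5]
    linarith
  · rw [pot_succ d h.pos, if_pos h6]
    have hv := even_flip_visited hf (not_lt.1 h1)
    rw [if_neg h4] at hv
    rw [visits_flip, Finset.insert_eq_of_mem hv]
    linarith
  · rw [pot_succ d h.pos, if_neg h6]
    linarith

theorem sum_excess_le {d : ℕ} {lam : ℝ} (h : IsRate d lam) (m : ℕ) :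
    ∑ f ∈ paths d m, excess d lam m f ≤ decay d lam * m * (lam ^ m * (2 * (lam + 1))) := by
  have hz : ∀ s : ℤ, excess d lam 0 (start s) = 0 := by
    intro s
    rw [excess, if_pos]
    rw [visits_zero]
    exact lt_of_le_of_lt (Finset.card_le_two) (by norm_num)
  -- subtracting a multiple of the unit potential absorbs the additive error of each step
  have h1 := sum_paths_le (d := d) h.pos.le
    (fun m f => excess d lam m f - decay d lam * m * pot d lam (age d f m) 1 1)
    (fun m f hf => ?_) m
  · simp only [hz, Nat.cast_zero, mul_zero, zero_mul, sub_zero, add_zero,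
      Finset.sum_sub_distrib] at h1
    rw [← Finset.mul_sum, h.sum_pot] at h1
    linarith
  · have h2 := excess_step h m hf
    have h3 := h.pot_one_succ (age d f m)
    have h4 : 0 ≤ decay d lam * (lam * pot d lam (age d f m) 1 1 - 1) :=
      mul_nonneg h.decay_pos.le (by nlinarith [h.one_le_pot (age d f m), h.one_le])
    simp only [age_keep, age_flip d m (mem_paths.1 hf).ne]
    push_cast
    split_ifs at h2 h3 ⊢ with hc
    · linear_combination h2 + h4 + decay d lam * (m + 1) * h3
    · linear_combination h2 + h4 + decay d lam * (m + 1) * h3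

theorem card_visits_sub_le_excess {d : ℕ} {lam : ℝ} (h : IsRate d lam) (m : ℕ) (f : ℕ → ℤ) :
    ((visits m f).card : ℝ) - 3 ≤ excess d lam m f := by
  rw [excess]
  split_ifs with h1 h2
  · have : ((visits m f).card : ℝ) < 3 := by exact_mod_cast h1
    linarith
  all_goals
    have : (3 : ℝ) ≤ (visits m f).card := by exact_mod_cast not_lt.1 h1
    refine le_pot_of_le h.one_le ?_ ?_ ?_ <;> linarith

/-- The mean number of values exceeds three by at most a multiple of the expected number of flips
at odd distance from their predecessor. -/
theorem sum_card_visits_le {d : ℕ} {lam : ℝ} (h : IsRate d lam) (m : ℕ) :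
    ∑ f ∈ paths d m, ((visits m f).card : ℝ) ≤
      (paths d m).card * (3 + 3 * m * decay d lam) := by
  have h1 : ∑ f ∈ paths d m, ((visits m f).card : ℝ) ≤
      ∑ f ∈ paths d m, (3 + excess d lam m f) :=
    Finset.sum_le_sum fun f _ => by linarith [card_visits_sub_le_excess h m f]
  rw [Finset.sum_add_distrib, Finset.sum_const, nsmul_eq_mul] at h1
  have h2 := sum_excess_le h m
  have h3 : decay d lam * m * (lam ^ m * (2 * (lam + 1))) ≤
      decay d lam * m * ((paths d m).card * 3) := by
    refine mul_le_mul_of_nonneg_left ?_ (mul_nonneg h.decay_pos.le (Nat.cast_nonneg m))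
    have := h.two_mul_pow_le_card m
    have := pow_pos h.pos m
    nlinarith [h.le]
  linarith

theorem decay_anti {d : ℕ} (hd : 1 ≤ d) {a b : ℝ} (ha : 0 < a) (hab : a ≤ b) :
    decay d b ≤ decay d a := by
  obtain ⟨e, rfl⟩ : ∃ e, d = e + 1 := ⟨d - 1, by omega⟩
  have hb : 0 < b := ha.trans_le hab
  have key : ∀ x : ℝ, 0 < x → decay (e + 1) x = x⁻¹ * ((x ^ 2)⁻¹) ^ e := by
    intro x hx
    rw [decay, pow_succ]
    field_simp
  rw [key a ha, key b hb]
  have h1 : (b ^ 2)⁻¹ ≤ (a ^ 2)⁻¹ := inv_anti₀ (by positivity) (by nlinarith)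
  exact mul_le_mul (inv_anti₀ ha hab) (pow_le_pow_left₀ (by positivity) h1 e) (by positivity)
    (by positivity)

theorem decay_le_one {d : ℕ} (hd : 1 ≤ d) {A : ℝ} (hA : 1 ≤ A) : decay d A ≤ 1 :=
  (decay_anti hd one_pos hA).trans (by simp [decay])

/-! ### Confinement -/

/-- An eigenfunction of the flip dynamics. Write `(x, y)` for the last two values before a flip,
which leads to `(2 * x - y, x)`. On the left are the weights of the states that a further flip
reaches after an even and an odd number of steps. The phase `ψ` makes the sine terms cancel. -/
theorem cos_wave {θ ψ e : ℝ} (hψ : Real.sin ψ = e * Real.sin θ) {x y : ℝ} (hxy : |x - y| = 1) :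
    Real.cos (θ * x + (x - (2 * x - y)) * ψ / 2) +
        e * Real.cos (θ * (2 * x - y) + (2 * x - y - x) * ψ / 2) =
      (Real.cos ψ + e * Real.cos θ) * Real.cos (θ * x + (x - y) * ψ / 2) := by
  rcases (abs_eq (by norm_num)).1 hxy with h | h
  · obtain rfl : y = x - 1 := by linarith
    rw [show θ * x + (x - (2 * x - (x - 1))) * ψ / 2 = (θ * x + ψ / 2) - ψ by ring,
      show θ * (2 * x - (x - 1)) + (2 * x - (x - 1) - x) * ψ / 2 = (θ * x + ψ / 2) + θ by ring,
      show θ * x + (x - (x - 1)) * ψ / 2 = θ * x + ψ / 2 by ring,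
      Real.cos_sub (θ * x + ψ / 2) ψ, Real.cos_add (θ * x + ψ / 2) θ, hψ]
    ring
  · obtain rfl : y = x + 1 := by linarith
    rw [show θ * x + (x - (2 * x - (x + 1))) * ψ / 2 = (θ * x - ψ / 2) + ψ by ring,
      show θ * (2 * x - (x + 1)) + (2 * x - (x + 1) - x) * ψ / 2 = (θ * x - ψ / 2) - θ by ring,
      show θ * x + (x - (x + 1)) * ψ / 2 = θ * x - ψ / 2 by ring,
      Real.cos_add (θ * x - ψ / 2) ψ, Real.cos_sub (θ * x - ψ / 2) θ, hψ]
    ring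

theorem IsPath.abs_cast_sub {d m : ℕ} {f : ℕ → ℤ} (h : IsPath d m f) :
    |(f (m + 1) : ℝ) - f m| = 1 := by exact_mod_cast h.step

theorem confined_succ {m R : ℕ} {f g : ℕ → ℤ} (h : ∀ i ≤ m + 1, g i = f i) :
    (∀ i ≤ m + 1 + 1, |g i| ≤ R) ↔ (∀ i ≤ m + 1, |f i| ≤ R) ∧ |g (m + 2)| ≤ R := by
  constructor
  · intro H
    exact ⟨fun i hi => by rw [← h i hi]; exact H i (by omega), H _ le_rfl⟩
  · rintro ⟨H1, H2⟩ i hi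
    rcases Nat.lt_or_ge i (m + 2) with h1 | h1
    · rw [h i (by omega)]; exact H1 i (by omega)
    · obtain rfl : i = m + 2 := by omega
      exact H2

/-- Confined paths are counted with the cosine potential, which is at least `1 / 2` on all states
that matter because `θ = 1 / (R + 1)`. -/
theorem card_confined_le_pow {d : ℕ} (hd : 1 ≤ d) {A : ℝ} (hA1 : 1 ≤ A) (hA2 : A ≤ 2) (R : ℕ)
    (hA : 2 + decay d A * Real.cos (1 / (R + 1)) ≤ A ^ 2) (m : ℕ) :
    (((paths d m).filter fun f => ∀ i ≤ m + 1, |f i| ≤ (R : ℤ)).card : ℝ) ≤ 12 * A ^ m := by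
  set e := decay d A
  have he0 : 0 < e := decay_pos d (by linarith)
  have he1 : e ≤ 1 := decay_le_one hd hA1
  set θ : ℝ := 1 / (R + 1) with hθ
  have hR : θ * (R + 1) = 1 := by rw [hθ]; field_simp
  have hθ0 : 0 < θ := by positivity
  have hθ1 : θ ≤ 1 := by nlinarith [Nat.cast_nonneg (α := ℝ) R]
  have hπ := Real.pi_gt_three
  have hs0 : 0 < Real.sin θ := Real.sin_pos_of_pos_of_lt_pi hθ0 (by linarith)
  have hs1 := Real.sin_le_one θ
  set ψ := Real.arcsin (e * Real.sin θ) with hψdef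
  have hψ : Real.sin ψ = e * Real.sin θ :=
    Real.sin_arcsin (by nlinarith) (by nlinarith)
  have hψ0 : 0 ≤ ψ := Real.arcsin_nonneg.2 (by positivity)
  have hψ1 : ψ ≤ θ := by
    calc ψ ≤ Real.arcsin (Real.sin θ) := Real.monotone_arcsin (by nlinarith)
      _ = θ := Real.arcsin_sin (by linarith) (by linarith)
  have hlow : ∀ x y : ℝ, |x| ≤ R → |x - y| = 1 →
      1 / 2 ≤ Real.cos (θ * x + (x - y) * ψ / 2) := by
    intro x y hx hxy
    have h1 : |θ * x + (x - y) * ψ / 2| ≤ 1 := by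
      calc |θ * x + (x - y) * ψ / 2| ≤ |θ * x| + |(x - y) * ψ / 2| := abs_add_le _ _
        _ = θ * |x| + ψ / 2 := by
            rw [abs_mul, abs_of_pos hθ0, mul_div_assoc, abs_mul, hxy, one_mul,
              abs_of_nonneg (show 0 ≤ ψ / 2 by linarith)]
        _ ≤ 1 := by nlinarith
    have h2 := Real.one_sub_sq_div_two_le_cos (x := θ * x + (x - y) * ψ / 2)
    have h3 := (sq_le_one_iff_abs_le_one _).2 h1
    linarith
  have h := sum_paths_le (d := d) (A := A) (by linarith)
    (fun m f => if ∀ i ≤ m + 1, |f i| ≤ (R : ℤ) then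
      pot d A (age d f m) (Real.cos (θ * f (m + 1) + (f (m + 1) - f m) * ψ / 2))
        (Real.cos (θ * f m + (f m - f (m + 1)) * ψ / 2)) else 0) (fun m f hf => ?_) m
  · have hfin := mul_card_filter_le (d := d) (m := m) (c := 1 / 2)
      (P := fun f => ∀ i ≤ m + 1, |f i| ≤ (R : ℤ)) (Ψ := fun f => _) (fun f hf => ?_)
      (fun f hf hP => ?_) |>.trans h
    · have hstart : ∀ s : ℤ, (if ∀ i ≤ 0 + 1, |start s i| ≤ (R : ℤ) then
          pot d A (age d (start s) 0)
            (Real.cos (θ * start s (0 + 1) + (start s (0 + 1) - start s 0) * ψ / 2))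
            (Real.cos (θ * start s 0 + (start s 0 - start s (0 + 1)) * ψ / 2)) else 0) ≤ 3 := by
        intro s
        split_ifs
        · simp only [age, pot_start]
          have := Real.cos_le_one
            (θ * start s (0 + 1) + (start s (0 + 1) - start s 0) * ψ / 2)
          have := Real.cos_le_one (θ * start s 0 + (start s 0 - start s (0 + 1)) * ψ / 2)
          nlinarith
        · norm_num
      have h1 := hstart 1
      have h2 := hstart (-1)
      have h3 : 0 ≤ A ^ m := by positivity
      nlinarith
    · have hp := (mem_paths.1 hf).abs_cast_sub
      split_ifs with hP
      · refine le_trans (by norm_num) (le_pot_of_le (c := 1 / 2) hA1 (by norm_num)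
          (hlow _ _ ?_ hp) (hlow _ _ ?_ ?_))
        · exact_mod_cast hP (m + 1) le_rfl
        · exact_mod_cast hP m (by omega)
        · rw [abs_sub_comm]; exact hp
      · exact le_rfl
    · have hp := (mem_paths.1 hf).abs_cast_sub
      rw [if_pos hP]
      refine le_pot_of_le hA1 (by norm_num) (hlow _ _ ?_ hp) (hlow _ _ ?_ ?_)
      · exact_mod_cast hP (m + 1) le_rfl
      · exact_mod_cast hP m (by omega)
      · rw [abs_sub_comm]; exact hp
  · have hp := (mem_paths.1 hf)
    have habs := hp.abs_cast_sub
    simp only [confined_succ fun i hi => keep_of_le f hi,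
      confined_succ fun i hi => flip_of_le f hi, age_keep, age_flip d m hp.ne,
      show m + 1 + 1 = m + 2 from rfl, keep_new, keep_last, flip_new, flip_last]
    by_cases hP : ∀ i ≤ m + 1, |f i| ≤ (R : ℤ)
    · rw [if_pos ⟨hP, hP m (by omega)⟩, if_pos hP, pot_succ d (by linarith)]
      have hp0 := hlow (f (m + 1)) (f m) (by exact_mod_cast hP (m + 1) le_rfl) habs
      refine add_le_add le_rfl ?_
      split_ifs with hc h2
      · push_cast
        rw [pot_zero, cos_wave hψ habs]
        refine mul_le_mul_of_nonneg_right ?_ (by linarith)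
        have := Real.cos_le_one ψ
        linarith
      · exact mul_nonneg (by nlinarith) (by linarith)
      · exact le_rfl
    · simp [hP]

/-- Staying in `[-R, R]` costs a factor exponentially small in `m * decay d lam / (R + 1) ^ 2`. -/
theorem IsRate.card_confined_le {d : ℕ} (hd : 1 ≤ d) {lam : ℝ} (h : IsRate d lam) (R m : ℕ) :
    (((paths d m).filter fun f => ∀ i ≤ m + 1, |f i| ≤ (R : ℤ)).card : ℝ) ≤
      6 * Real.exp (-(m * decay d lam / (40 * (R + 1) ^ 2))) * (paths d m).card := by
  set e := decay d lam with hedef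
  have he0 : 0 < e := h.decay_pos
  have he1 : e ≤ 1 := h.decay_le_one hd
  set θ : ℝ := 1 / (R + 1) with hθ
  have hθ0 : 0 < θ := by positivity
  have hθ1 : θ ≤ 1 := by
    rw [hθ, div_le_one (by positivity)]; linarith [Nat.cast_nonneg (α := ℝ) R]
  have hπ := Real.pi_gt_three
  have hcos0 : 0 ≤ Real.cos θ := Real.cos_nonneg_of_neg_pi_div_two_le_of_le
    (by linarith) (by linarith)
  have hcos1 : θ ^ 2 / 5 ≤ 1 - Real.cos θ := by
    have h1 := Real.cos_le_one_sub_mul_cos_sq (x := θ) (by rw [abs_of_pos hθ0]; linarith)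
    have h2 : 1 / 5 ≤ 2 / Real.pi ^ 2 := by
      rw [div_le_div_iff₀ (by norm_num) (by positivity)]
      nlinarith [Real.pi_lt_d2]
    nlinarith [sq_nonneg θ]
  -- the loss in the growth rate caused by the confinement
  set ω := e * (1 - Real.cos θ) / 8 with hω
  have hω0 : 0 ≤ ω := by
    have : 0 ≤ 1 - Real.cos θ := by linarith [Real.cos_le_one θ]
    positivity
  have hω1 : ω ≤ 1 / 8 := by rw [hω]; nlinarith
  have hsq := h.sq
  have hlam14 : (7 : ℝ) / 5 ≤ lam := by nlinarith [h.two_le_sq, h.one_le]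
  have hmd := h.mul_decay_le
  have hd1 : (1 : ℝ) ≤ d := by exact_mod_cast hd
  have hdω : (2 * d - 1 : ℝ) * ω ≤ 7 / 32 := by
    have h1 : (2 * d - 1 : ℝ) * ω = ((2 * d - 1) * e) * (1 - Real.cos θ) / 8 := by rw [hω]; ring
    have h2 : 0 ≤ (2 * d - 1 : ℝ) * e := mul_nonneg (by linarith) he0.le
    rw [h1]
    nlinarith
  have hdecay : decay d (lam * (1 - ω)) * (1 - (2 * d - 1) * ω) ≤ e := by
    obtain ⟨c, rfl⟩ : ∃ c, d = c + 1 := ⟨d - 1, by omega⟩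
    have h1 : decay (c + 1) (lam * (1 - ω)) = e * ((1 - ω) ^ (2 * c + 1))⁻¹ := by
      have : (1 - ω) ≠ 0 := by linarith
      rw [hedef, decay, decay, mul_pow, mul_inv, mul_pow, inv_pow ((1 - ω) ^ 2), ← pow_mul,
        show 2 * (c + 1) = 2 * c + 1 + 1 by ring, pow_succ (1 - ω)]
      field_simp
    have h2 : 1 - (2 * ((c + 1 : ℕ) : ℝ) - 1) * ω ≤ (1 - ω) ^ (2 * c + 1) := by
      have := one_add_mul_le_pow (a := -ω) (by linarith) (2 * c + 1)
      push_cast at this ⊢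
      rw [← sub_eq_add_neg 1 ω] at this
      linarith
    have h3 : 0 < (1 - ω) ^ (2 * c + 1) := pow_pos (by linarith) _
    rw [h1, mul_assoc]
    refine mul_le_of_le_one_right he0.le ?_
    rw [inv_mul_le_one₀ h3]
    exact h2
  have hA : 2 + decay d (lam * (1 - ω)) * Real.cos θ ≤ (lam * (1 - ω)) ^ 2 := by
    -- this is where the factor `8` in the choice of `ω` is needed
    have hg : e * Real.cos θ ≤ (e - 49 / 8 * ω) * (1 - (2 * d - 1) * ω) := by
      have h1 : e * Real.cos θ = e - 8 * ω := by rw [hω]; ring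
      have h2 : ω * ((2 * d - 1) * e) ≤ ω * (7 / 4) := mul_le_mul_of_nonneg_left hmd hω0
      have h3 : 0 ≤ (2 * d - 1 : ℝ) * ω * ω :=
        mul_nonneg (mul_nonneg (by linarith) hω0) hω0
      rw [h1]
      nlinarith
    have hq : 0 < 1 - (2 * d - 1 : ℝ) * ω := by linarith
    have h4 : decay d (lam * (1 - ω)) * Real.cos θ ≤ e - 49 / 8 * ω := by
      refine le_of_mul_le_mul_right ?_ hq
      calc _ = decay d (lam * (1 - ω)) * (1 - (2 * d - 1) * ω) * Real.cos θ := by ring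
        _ ≤ e * Real.cos θ := mul_le_mul_of_nonneg_right hdecay hcos0
        _ ≤ _ := hg
    have h5 : lam ^ 2 ≤ 49 / 16 := by nlinarith [h.le, h.one_le]
    have h6 : (lam * (1 - ω)) ^ 2 = lam ^ 2 - 2 * lam ^ 2 * ω + lam ^ 2 * ω ^ 2 := by ring
    have h7 : 0 ≤ lam ^ 2 * ω ^ 2 := by positivity
    rw [h6]
    nlinarith
  have hcount := card_confined_le_pow hd (A := lam * (1 - ω)) (by nlinarith)
    (by nlinarith [h.le]) R hA m
  have hexp : (1 - ω) ^ m ≤ Real.exp (-(m * e / (40 * (R + 1) ^ 2))) := by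
    calc (1 - ω) ^ m ≤ Real.exp (-ω) ^ m :=
          pow_le_pow_left₀ (by linarith) (by linarith [Real.add_one_le_exp (-ω)]) m
      _ = Real.exp (-(m * ω)) := by rw [← Real.exp_nat_mul]; ring_nf
      _ ≤ _ := by
          refine Real.exp_le_exp.2 (neg_le_neg ?_)
          have h1 : e * θ ^ 2 / 40 ≤ ω := by rw [hω]; nlinarith
          calc m * e / (40 * (R + 1) ^ 2) = m * (e * θ ^ 2 / 40) := by rw [hθ]; field_simp
            _ ≤ m * ω := mul_le_mul_of_nonneg_left h1 (Nat.cast_nonneg m)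
  have hcard := h.two_mul_pow_le_card m
  have hpos := pow_pos h.pos m
  rw [mul_pow] at hcount
  have hE := Real.exp_pos (-(m * e / (40 * (R + 1) ^ 2)))
  calc _ ≤ 12 * (lam ^ m * (1 - ω) ^ m) := hcount
    _ ≤ 12 * (lam ^ m * Real.exp (-(m * e / (40 * (R + 1) ^ 2)))) := by gcongr
    _ = 6 * Real.exp (-(m * e / (40 * (R + 1) ^ 2))) * (2 * lam ^ m) := by ring
    _ ≤ _ := by gcongr

/-! ### Hitting probabilities -/

/-- The hyperbolic counterpart of `cos_wave`. -/
theorem cosh_wave {θ ψ e : ℝ} (hψ : Real.sinh ψ = e * Real.sinh θ) {x y : ℝ} (hxy : |x - y| = 1) :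
    Real.cosh (θ * x + (x - (2 * x - y)) * ψ / 2) +
        e * Real.cosh (θ * (2 * x - y) + (2 * x - y - x) * ψ / 2) =
      (Real.cosh ψ + e * Real.cosh θ) * Real.cosh (θ * x + (x - y) * ψ / 2) := by
  rcases (abs_eq (by norm_num)).1 hxy with h | h
  · obtain rfl : y = x - 1 := by linarith
    rw [show θ * x + (x - (2 * x - (x - 1))) * ψ / 2 = (θ * x + ψ / 2) - ψ by ring,
      show θ * (2 * x - (x - 1)) + (2 * x - (x - 1) - x) * ψ / 2 = (θ * x + ψ / 2) + θ by ring,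
      show θ * x + (x - (x - 1)) * ψ / 2 = θ * x + ψ / 2 by ring,
      Real.cosh_sub (θ * x + ψ / 2) ψ, Real.cosh_add (θ * x + ψ / 2) θ, hψ]
    ring
  · obtain rfl : y = x + 1 := by linarith
    rw [show θ * x + (x - (2 * x - (x + 1))) * ψ / 2 = (θ * x - ψ / 2) + ψ by ring,
      show θ * (2 * x - (x + 1)) + (2 * x - (x + 1) - x) * ψ / 2 = (θ * x - ψ / 2) - θ by ring,
      show θ * x + (x - (x + 1)) * ψ / 2 = θ * x - ψ / 2 by ring,
      Real.cosh_add (θ * x - ψ / 2) ψ, Real.cosh_sub (θ * x - ψ / 2) θ, hψ]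
    ring

theorem half_exp_abs_le_cosh (z : ℝ) : Real.exp |z| / 2 ≤ Real.cosh z := by
  rw [← Real.cosh_abs, Real.cosh_eq]
  have := Real.exp_pos (-|z|)
  linarith

theorem cosh_le_exp_abs (z : ℝ) : Real.cosh z ≤ Real.exp |z| := by
  rw [← Real.cosh_abs, Real.cosh_eq]
  have : Real.exp (-|z|) ≤ Real.exp |z| := Real.exp_le_exp.2 (by linarith [abs_nonneg z])
  linarith

theorem cosh_le_of_sinh (z : ℝ) : Real.cosh z ≤ 1 + Real.sinh z ^ 2 / 2 := by
  have h1 := Real.cosh_sq z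
  have h2 := Real.one_le_cosh z
  nlinarith [sq_nonneg (Real.cosh z - 1)]

/-- Few paths visit a distant value `v`. Before the visit the hyperbolic cosine potential is used,
after it the unit potential. -/
theorem IsRate.card_hit_le_pow {d : ℕ} (hd : 1 ≤ d) {lam : ℝ} (h : IsRate d lam) {r : ℝ}
    (hr0 : 0 < r) (hr1 : r ≤ 1) {v : ℤ} (hv : 2 ≤ v.natAbs) (m : ℕ) :
    (((paths d m).filter fun f => v ∈ visits m f).card : ℝ) ≤
      2592 * Real.exp (-Real.arsinh r) ^ v.natAbs * √(lam ^ 2 + decay d lam * r ^ 2) ^ m := by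
  set e := decay d lam with hedef
  have he0 : 0 < e := h.decay_pos
  have he1 : e ≤ 1 := h.decay_le_one hd
  set θ := Real.arsinh r with hθ
  have hθ0 : 0 < θ := Real.arsinh_pos_iff.2 hr0
  have hθs : Real.sinh θ = r := Real.sinh_arsinh r
  set ψ := Real.arsinh (e * r) with hψdef
  have hψs : Real.sinh ψ = e * r := Real.sinh_arsinh _
  have hψ : Real.sinh ψ = e * Real.sinh θ := by rw [hψs, hθs]
  have hψ0 : 0 ≤ ψ := Real.arsinh_nonneg_iff.2 (by positivity)
  have hψ1 : ψ ≤ θ := Real.arsinh_le_arsinh.2 (by nlinarith)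
  have hexpθ : Real.exp (2 * θ) ≤ 9 := by
    have h1 : Real.exp θ ≤ 3 := by
      rw [hθ, Real.exp_arsinh]
      have : √(1 + r ^ 2) ≤ 2 := Real.sqrt_le_iff.2 ⟨by norm_num, by nlinarith⟩
      linarith
    rw [two_mul, Real.exp_add]
    nlinarith [Real.exp_pos θ]
  set A := √(lam ^ 2 + e * r ^ 2) with hAdef
  have hAsq : A ^ 2 = lam ^ 2 + e * r ^ 2 := Real.sq_sqrt (by positivity)
  have hlamA : lam ≤ A := Real.le_sqrt_of_sq_le (by nlinarith [sq_nonneg r])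
  have hA1 : 1 ≤ A := h.one_le.trans hlamA
  have hA3 : A ≤ 3 := Real.sqrt_le_iff.2
    ⟨by norm_num, by nlinarith [h.le, h.one_le, sq_nonneg r]⟩
  have hsup : Real.cosh ψ + e * Real.cosh θ ≤ A ^ 2 - 1 := by
    have h1 := cosh_le_of_sinh ψ
    have h2 := cosh_le_of_sinh θ
    rw [hψs] at h1
    rw [hθs] at h2
    have h3 : e * Real.cosh θ ≤ e * (1 + r ^ 2 / 2) := mul_le_mul_of_nonneg_left h2 he0.le
    have h4 : (e * r) ^ 2 ≤ e * r ^ 2 := by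
      have : 0 ≤ e * r ^ 2 * (1 - e) := mul_nonneg (by positivity) (by linarith)
      nlinarith
    rw [hAsq, h.sq]
    linarith
  have hdec : decay d A ≤ e := decay_anti hd h.pos hlamA
  set D := 36 * Real.exp (-θ) ^ v.natAbs with hD
  have hD0 : 0 < D := by positivity
  have hne : ∀ s : ℤ, s.natAbs = 1 → v ∉ visits 0 (start s) := by
    intro s hs
    rw [visits_zero]
    simp only [Finset.mem_insert, Finset.mem_singleton, not_or]
    omega
  have hmain := sum_paths_le (d := d) (A := A) (by linarith)
    (fun m f => if v ∈ visits m f then pot d lam (age d f m) 1 1 else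
      D * pot d A (age d f m) (Real.cosh (θ * f (m + 1) + (f (m + 1) - f m) * ψ / 2))
        (Real.cosh (θ * f m + (f m - f (m + 1)) * ψ / 2))) (fun m f hf => ?_) m
  · have hfin := mul_card_filter_le (d := d) (m := m) (c := 1)
      (P := fun f => v ∈ visits m f) (Ψ := fun f => _) (fun f hf => ?_)
      (fun f hf hP => ?_) |>.trans hmain
    · have hstart : ∀ s : ℤ, |(s : ℝ)| = 1 →
          pot d A (age d (start s) 0)
            (Real.cosh (θ * start s (0 + 1) + (start s (0 + 1) - start s 0) * ψ / 2))
            (Real.cosh (θ * start s 0 + (start s 0 - start s (0 + 1)) * ψ / 2)) ≤ 36 := by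
        intro s hs
        simp only [age, pot_start, zero_add, start_one, start_zero, Int.cast_zero, mul_zero,
          sub_zero, zero_sub]
        have h1 : Real.cosh (θ * s + s * ψ / 2) ≤ 9 := by
          refine (cosh_le_exp_abs _).trans ((Real.exp_le_exp.2 ?_).trans hexpθ)
          rw [show θ * s + s * ψ / 2 = s * (θ + ψ / 2) by ring, abs_mul, hs,
            abs_of_nonneg (by linarith)]
          linarith
        have h2 : Real.cosh (-(s : ℝ) * ψ / 2) ≤ 9 := by
          refine (cosh_le_exp_abs _).trans ((Real.exp_le_exp.2 ?_).trans hexpθ)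
          rw [mul_div_assoc, abs_mul, abs_neg, hs, abs_of_nonneg (by linarith)]
          linarith
        have h3 := Real.one_le_cosh (θ * s + s * ψ / 2)
        nlinarith
      have h1 := hstart 1 (by simp)
      have h2 := hstart (-1) (by simp)
      rw [if_neg (hne 1 (by simp)), if_neg (hne (-1) (by simp)), one_mul] at hfin
      refine hfin.trans ?_
      have h3 : 0 ≤ A ^ m := by positivity
      calc _ ≤ A ^ m * (D * 36 + D * 36) := by gcongr
        _ = _ := by rw [hD]; ring
    · split_ifs
      · linarith [h.one_le_pot (age d f m)]
      · exact mul_nonneg hD0.le (zero_le_one.trans (le_pot_of_le hA1 zero_le_one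
          (Real.one_le_cosh _) (Real.one_le_cosh _)))
    · rw [if_pos hP]
      exact h.one_le_pot _
  · have hp := (mem_paths.1 hf)
    have habs := hp.abs_cast_sub
    simp only [visits_keep, visits_flip, age_keep, age_flip d m hp.ne,
      show m + 1 + 1 = m + 2 from rfl, keep_new, keep_last, flip_new, flip_last]
    by_cases hP : v ∈ visits m f
    · rw [if_pos hP, if_pos hP, if_pos (Finset.mem_insert_of_mem hP), ← h.pot_one_succ]
      exact mul_le_mul_of_nonneg_right hlamA (zero_le_one.trans (h.one_le_pot _))
    · rw [if_neg hP, if_neg hP, mul_left_comm, pot_succ d (by linarith), mul_add]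
      refine add_le_add le_rfl ?_
      split_ifs with hc h2
      · -- the first visit to `v`
        have hvx : v = 2 * f (m + 1) - f m := by
          simpa [hP] using h2
        rw [pot_zero, ← hedef]
        set z := θ * (f (m + 1) : ℝ) + ((f (m + 1) : ℝ) - f m) * ψ / 2 with hz
        have hn : (v.natAbs : ℝ) ≤ |(f (m + 1) : ℝ)| + 1 := by
          rw [Nat.cast_natAbs, hvx]
          push_cast
          calc |2 * (f (m + 1) : ℝ) - f m| = |(f (m + 1) : ℝ) + (f (m + 1) - f m)| := by ring_nf
            _ ≤ _ := by rw [← habs]; exact abs_add_le _ _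
        have h3 : θ * v.natAbs - 2 * θ ≤ |z| := by
          have h4 : |θ * (f (m + 1) : ℝ)| - |-(((f (m + 1) : ℝ) - f m) * ψ / 2)| ≤ |z| := by
            have h5 : z = θ * (f (m + 1) : ℝ) - -(((f (m + 1) : ℝ) - f m) * ψ / 2) := by
              rw [hz]; ring
            rw [h5]
            exact abs_sub_abs_le_abs_sub _ _
          rw [abs_neg, mul_div_assoc, abs_mul, abs_mul, habs, abs_of_pos hθ0, one_mul,
            abs_of_nonneg (show 0 ≤ ψ / 2 by linarith)] at h4
          nlinarith
        have h5 : 1 ≤ 18 * (Real.exp (-θ) ^ v.natAbs * Real.cosh z) := by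
          have h6 := half_exp_abs_le_cosh z
          have h7 := Real.exp_le_exp.2 h3
          have h8 : Real.exp (-θ) ^ v.natAbs * (Real.exp (θ * v.natAbs - 2 * θ) *
              Real.exp (2 * θ)) = 1 := by
            rw [← Real.exp_nat_mul, ← Real.exp_add, ← Real.exp_add, Real.exp_eq_one_iff]
            ring
          calc (1 : ℝ) = Real.exp (-θ) ^ v.natAbs * (Real.exp (θ * v.natAbs - 2 * θ) *
              Real.exp (2 * θ)) := h8.symm
            _ ≤ Real.exp (-θ) ^ v.natAbs * ((2 * Real.cosh z) * 9) := by
                gcongr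
                linarith
            _ = _ := by ring
        have h9 : 1 ≤ A ^ 2 - 1 := by rw [hAsq]; nlinarith [h.two_le_sq, sq_nonneg r]
        have h10 : 2 ≤ D * Real.cosh z := by rw [hD]; linarith
        nlinarith
      · push_cast
        refine mul_le_mul_of_nonneg_left ?_ hD0.le
        rw [pot_zero]
        refine le_trans ?_ ((cosh_wave hψ habs).le.trans (mul_le_mul_of_nonneg_right hsup
          (zero_le_one.trans (Real.one_le_cosh _))))
        gcongr
      · simp

theorem IsRate.card_hit_le {d : ℕ} (hd : 1 ≤ d) {lam : ℝ} (h : IsRate d lam) {r : ℝ}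
    (hr0 : 0 < r) (hr1 : r ≤ 1) (v : ℤ) (m : ℕ) :
    (((paths d m).filter fun f => v ∈ visits m f).card : ℝ) ≤
      1296 * Real.exp (m * decay d lam * r ^ 2) * Real.exp (-Real.arsinh r) ^ v.natAbs *
        (paths d m).card := by
  have he0 : 0 < decay d lam := h.decay_pos
  have hE1 : 1 ≤ Real.exp (m * decay d lam * r ^ 2) := Real.one_le_exp (by positivity)
  have hcard := h.two_mul_pow_le_card m
  rcases Nat.lt_or_ge v.natAbs 2 with hv | hv
  · have h1 : (((paths d m).filter fun f => v ∈ visits m f).card : ℝ) ≤ (paths d m).card := by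
      exact_mod_cast Finset.card_filter_le _ _
    refine h1.trans (le_mul_of_one_le_left (Nat.cast_nonneg _) ?_)
    have h2 : 1 / 3 ≤ Real.exp (-Real.arsinh r) := by
      rw [Real.exp_neg, Real.exp_arsinh, one_div]
      have : √(1 + r ^ 2) ≤ 2 := Real.sqrt_le_iff.2 ⟨by norm_num, by nlinarith⟩
      exact inv_anti₀ (by positivity) (by linarith)
    have h3 : 1 / 3 ≤ Real.exp (-Real.arsinh r) ^ v.natAbs := by
      interval_cases v.natAbs
      · norm_num
      · simpa using h2
    nlinarith
  · have h1 := h.card_hit_le_pow hd hr0 hr1 hv m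
    have h2 : √(lam ^ 2 + decay d lam * r ^ 2) ^ m ≤
        lam ^ m * Real.exp (m * decay d lam * r ^ 2) := by
      have h3 : √(lam ^ 2 + decay d lam * r ^ 2) ≤ lam * Real.exp (decay d lam * r ^ 2) := by
        refine Real.sqrt_le_iff.2 ⟨mul_nonneg h.pos.le (Real.exp_pos _).le, ?_⟩
        have h4 := Real.add_one_le_exp (decay d lam * r ^ 2)
        have h5 : 0 ≤ decay d lam * r ^ 2 := by positivity
        have h6 : 1 + decay d lam * r ^ 2 ≤ Real.exp (decay d lam * r ^ 2) ^ 2 := by nlinarith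
        rw [mul_pow]
        nlinarith [h.two_le_sq]
      calc _ ≤ (lam * Real.exp (decay d lam * r ^ 2)) ^ m :=
            pow_le_pow_left₀ (Real.sqrt_nonneg _) h3 m
        _ = _ := by rw [mul_pow, ← Real.exp_nat_mul, mul_assoc (m : ℝ)]
    calc _ ≤ 2592 * Real.exp (-Real.arsinh r) ^ v.natAbs *
            √(lam ^ 2 + decay d lam * r ^ 2) ^ m := by exact h1
      _ ≤ 2592 * Real.exp (-Real.arsinh r) ^ v.natAbs *
            (lam ^ m * Real.exp (m * decay d lam * r ^ 2)) := by gcongr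
      _ = 1296 * Real.exp (m * decay d lam * r ^ 2) * Real.exp (-Real.arsinh r) ^ v.natAbs *
            (2 * lam ^ m) := by ring
      _ ≤ _ := by gcongr

theorem sum_pow_natAbs_le {q : ℝ} (hq0 : 0 ≤ q) (hq1 : q < 1) (V : Finset ℤ) :
    ∑ v ∈ V, q ^ v.natAbs ≤ 2 / (1 - q) := by
  have key : ∀ W : Finset ℤ, (Set.InjOn Int.natAbs (W : Set ℤ)) →
      ∑ v ∈ W, q ^ v.natAbs ≤ 1 / (1 - q) := by
    intro W hW
    rw [← Finset.sum_image (f := fun k => q ^ k) hW, one_div, ← tsum_geometric_of_lt_one hq0 hq1]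
    exact (summable_geometric_of_lt_one hq0 hq1).sum_le_tsum _ fun k _ => pow_nonneg hq0 k
  rw [← Finset.sum_filter_add_sum_filter_not V (fun v => 0 ≤ v)]
  have h1 := key (V.filter fun v => 0 ≤ v) fun a ha b hb hab => by
    simp only [Finset.coe_filter, Set.mem_ofPred_eq] at ha hb; omega
  have h2 := key (V.filter fun v => ¬ 0 ≤ v) fun a ha b hb hab => by
    simp only [Finset.coe_filter, Set.mem_ofPred_eq] at ha hb; omega
  rw [show (2 : ℝ) / (1 - q) = 1 / (1 - q) + 1 / (1 - q) by ring]
  exact add_le_add h1 h2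

/-- The mean number of values is of order at most `1 / r` as long as `m * decay d lam * r ^ 2` is
bounded. -/
theorem IsRate.sum_card_visits_le_div {d : ℕ} (hd : 1 ≤ d) {lam : ℝ} (h : IsRate d lam) {r : ℝ}
    (hr0 : 0 < r) (hr1 : r ≤ 1) (m : ℕ) :
    ∑ f ∈ paths d m, ((visits m f).card : ℝ) ≤
      (paths d m).card * (5184 * Real.exp (m * decay d lam * r ^ 2) / r) := by
  classical
  set V := (paths d m).biUnion (visits m) with hV
  have h1 : ∀ f ∈ paths d m, ((visits m f).card : ℝ) =
      ∑ v ∈ V, if v ∈ visits m f then (1 : ℝ) else 0 := by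
    intro f hf
    rw [← Finset.natCast_card_filter]
    congr 2
    ext v
    simp only [Finset.mem_filter, hV, Finset.mem_biUnion]
    exact ⟨fun hv => ⟨⟨f, hf, hv⟩, hv⟩, fun hv => hv.2⟩
  have hq : Real.exp (-Real.arsinh r) ≤ 1 - r / 2 := by
    rw [Real.exp_neg, Real.exp_arsinh]
    have h2 : 1 ≤ √(1 + r ^ 2) := Real.one_le_sqrt.2 (by nlinarith)
    have h3 : (r + √(1 + r ^ 2))⁻¹ ≤ (1 + r)⁻¹ := inv_anti₀ (by linarith) (by linarith)
    refine h3.trans ?_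
    rw [inv_le_iff_one_le_mul₀ (by linarith)]
    nlinarith
  rw [Finset.sum_congr rfl h1, Finset.sum_comm]
  calc _ ≤ ∑ v ∈ V, (1296 * Real.exp (m * decay d lam * r ^ 2) * (paths d m).card) *
          Real.exp (-Real.arsinh r) ^ v.natAbs := by
        refine Finset.sum_le_sum fun v _ => ?_
        rw [← Finset.natCast_card_filter]
        refine (h.card_hit_le hd hr0 hr1 v m).trans (le_of_eq ?_)
        ring
    _ = (1296 * Real.exp (m * decay d lam * r ^ 2) * (paths d m).card) *
          ∑ v ∈ V, Real.exp (-Real.arsinh r) ^ v.natAbs := by rw [Finset.mul_sum]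
    _ ≤ (1296 * Real.exp (m * decay d lam * r ^ 2) * (paths d m).card) * (4 / r) := by
        refine mul_le_mul_of_nonneg_left ?_ (by positivity)
        refine (sum_pow_natAbs_le (Real.exp_pos _).le (by linarith) V).trans ?_
        rw [div_le_div_iff₀ (by linarith) hr0]
        linarith
    _ = _ := by ring

/-! ### The uniform law -/

/-- Continuation of a function on `{0, …, n}` by zero. -/
def extend {n : ℕ} (f : Fin (n + 1) → ℤ) (i : ℕ) : ℤ := if h : i < n + 1 then f ⟨i, h⟩ else 0

theorem extend_val {n : ℕ} (f : Fin (n + 1) → ℤ) (i : Fin (n + 1)) : extend f i = f i := by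
  rw [extend, dif_pos i.2]

theorem isPath_extend_iff {d m : ℕ} {f : Fin (m + 1 + 1) → ℤ} :
    IsPath d m (extend f) ↔ f ∈ Hom (lineGraph (m + 1) d) 0 := by
  constructor
  · intro h
    refine ⟨by rw [← extend_val f 0]; exact h.zero, ?_⟩
    have key : ∀ x y : Fin (m + 1 + 1), (x : ℕ) < y → (lineGraph (m + 1) d).Adj x y →
        |f y - f x| = 1 := by
      rintro x y hxy ⟨k, hk, hadj⟩
      rw [← extend_val f x, ← extend_val f y]
      rw [abs_sub_comm, abs_of_pos (by omega)] at hadj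
      exact h.hom x y hxy (by omega) (by omega) (by omega)
    intro x y hadj
    rcases Nat.lt_trichotomy (x : ℕ) y with hxy | hxy | hxy
    · rw [abs_sub_comm]; exact key x y hxy hadj
    · exact absurd (Fin.ext hxy) hadj.ne
    · exact key y x hxy hadj.symm
  · rintro ⟨h0, h⟩
    refine ⟨by rw [← h0, ← extend_val f 0]; rfl, fun i hi => dif_neg (by omega), ?_⟩
    intro i j hij hj hpar hd
    rw [extend, extend, dif_pos (by omega), dif_pos (by omega)]
    refine h _ _ ⟨(j - i) / 2, by omega, ?_⟩
    simp only
    rw [abs_of_pos (by omega)]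
    omega

theorem extend_injective {n : ℕ} : Function.Injective (extend (n := n)) := by
  intro f g h
  funext i
  rw [← extend_val f, ← extend_val g, h]

theorem rangeSize_eq_card_visits {m : ℕ} (f : Fin (m + 1 + 1) → ℤ) :
    rangeSize f = (visits m (extend f)).card := by
  rw [rangeSize, ← Set.ncard_coe_finset]
  congr 1
  ext v
  simp only [Set.mem_range, Finset.mem_coe, mem_visits]
  exact ⟨fun ⟨i, hi⟩ => ⟨i, by omega, by rw [extend_val, hi]⟩,
    fun ⟨i, hi, h⟩ => ⟨⟨i, by omega⟩, (extend_val f ⟨i, by omega⟩).symm.trans h⟩⟩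

theorem sum_hom_eq (d m : ℕ) (F : (ℕ → ℤ) → ℝ) :
    ∑ f ∈ (hom_lineGraph_finite (m + 1) d).toFinset, F (extend f) = ∑ g ∈ paths d m, F g := by
  refine Finset.sum_bij (fun f _ => extend f) (fun f hf => ?_)
    (fun f _ g _ h => extend_injective h) (fun g hg => ?_) (fun _ _ => rfl)
  · rw [Set.Finite.mem_toFinset] at hf
    exact mem_paths.2 (isPath_extend_iff.2 hf)
  · have hg' : extend (fun i : Fin (m + 1 + 1) => g i) = g := by
      funext i
      rw [extend]
      split_ifs with h
      · rfl
      · exact ((mem_paths.1 hg).beyond i (by omega)).symm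
    refine ⟨fun i => g i, ?_, hg'⟩
    rw [Set.Finite.mem_toFinset, ← isPath_extend_iff, hg']
    exact mem_paths.1 hg

theorem integral_lineLaw (d m : ℕ) (F : (ℕ → ℤ) → ℝ) :
    ∫ f, F (extend f) ∂(lineLaw (m + 1) d) =
      (∑ g ∈ paths d m, F g) / (paths d m).card := by
  set H := (hom_lineGraph_finite (m + 1) d).toFinset with hH
  have hcoe : Hom (lineGraph (m + 1) d) 0 = (H : Set (Fin (m + 1 + 1) → ℤ)) :=
    (Set.Finite.coe_toFinset _).symm
  have hcard : (H.card : ℝ) = (paths d m).card := by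
    have := sum_hom_eq d m (fun _ => 1)
    simpa using this
  rw [lineLaw, uniformOn, ProbabilityTheory.cond, hcoe, integral_smul_measure,
    Measure.count_apply_finset, setIntegral_finset]
  · simp only [measureReal_def, Measure.count_singleton, ENNReal.toReal_one,
    ENNReal.toReal_inv, ENNReal.toReal_natCast, smul_eq_mul, one_mul, ← hcard]
    rw [hH, sum_hom_eq, div_eq_inv_mul]
  · have h := (integrableOn_finset_iUnion (f := fun f => F (extend f)) (μ := Measure.count)
      (s := H) (t := fun x => {x})).2 fun x _ => integrableOn_singleton (by simp)
        (by simp)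
    convert h
    ext x
    simp

theorem real_lineLaw (d m : ℕ) (P : (ℕ → ℤ) → Prop) [DecidablePred P] :
    (lineLaw (m + 1) d).real {f | P (extend f)} =
      (((paths d m).filter P).card : ℝ) / (paths d m).card := by
  have h := integral_lineLaw d m (fun g => if P g then 1 else 0)
  rw [← Finset.natCast_card_filter] at h
  rw [← h, ← integral_indicator_one (MeasurableSet.of_discrete)]
  refine integral_congr_ae (Eventually.of_forall fun f => ?_)
  by_cases hP : P (extend f) <;> simp [Set.indicator, hP]

theorem card_paths_pos (d m : ℕ) : 0 < (paths d m).card := by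
  obtain ⟨f, hf⟩ := hom_lineGraph_nonempty (m + 1) d
  exact Finset.card_pos.2 ⟨extend f, mem_paths.2 (isPath_extend_iff.2 hf)⟩

/-! ### The scale `√(n * 2 ^ (-d))` -/

/-- The order of the number of flips at odd distance from their predecessor. -/
noncomputable def scale (n d : ℕ) : ℝ := (n : ℝ) * (2 : ℝ) ^ (-(d : ℝ))

theorem scale_eq (n d : ℕ) : scale n d = n / 2 ^ d := by
  rw [scale, Real.rpow_neg (by norm_num), Real.rpow_natCast, div_eq_mul_inv]

theorem scale_nonneg (n d : ℕ) : 0 ≤ scale n d := by rw [scale_eq]; positivity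

theorem IsRate.mul_decay_le_scale {d : ℕ} {lam : ℝ} (h : IsRate d lam) (m : ℕ) :
    m * decay d lam ≤ 7 / 4 * scale (m + 1) d := by
  rw [scale_eq]
  calc m * decay d lam ≤ (m + 1 : ℕ) * (7 / 4 / 2 ^ d) :=
        mul_le_mul (by push_cast; linarith) h.decay_le h.decay_pos.le (Nat.cast_nonneg _)
    _ = _ := by ring

theorem IsRate.scale_le_mul_decay {d : ℕ} {lam : ℝ} (h : IsRate d lam) {m : ℕ} (hm : 1 ≤ m) :
    scale (m + 1) d / 8 ≤ m * decay d lam := by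
  rw [scale_eq]
  have hm' : (1 : ℝ) ≤ m := by exact_mod_cast hm
  calc ((m + 1 : ℕ) : ℝ) / 2 ^ d / 8 = ((m + 1 : ℝ) / 2) * (1 / 4 / 2 ^ d) := by push_cast; ring
    _ ≤ m * decay d lam :=
        mul_le_mul (by linarith) h.le_decay (by positivity) (Nat.cast_nonneg m)

theorem two_le_of_one_le_scale {n d : ℕ} (hd : 1 ≤ d) (h : 1 ≤ scale n d) : 2 ≤ n := by
  rw [scale_eq, le_div_iff₀ (by positivity), one_mul] at h
  have : (2 : ℝ) ^ 1 ≤ 2 ^ d := pow_le_pow_right₀ (by norm_num) hd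
  have h2 : (2 : ℝ) ≤ n := by linarith
  exact_mod_cast h2

/-! ### Lower bounds for the range -/

theorem IsPath.visits_between {d m : ℕ} {f : ℕ → ℤ} (h : IsPath d m f) {i : ℕ} (hi : i ≤ m + 1)
    {v : ℤ} (hv : (0 ≤ v ∧ v ≤ f i) ∨ (f i ≤ v ∧ v ≤ 0)) : v ∈ visits m f := by
  induction i with
  | zero =>
    rw [h.zero] at hv
    refine mem_visits.2 ⟨0, by omega, ?_⟩
    rw [h.zero]; omega
  | succ i ih =>
    by_cases hvi : v = f (i + 1)
    · exact hvi ▸ apply_mem_visits f hi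
    · have h1 := h.hom i (i + 1) (by omega) hi (by omega) (by omega)
      refine ih (by omega) ?_
      rcases (abs_eq (by norm_num)).1 h1 with h2 | h2 <;> omega

theorem IsPath.abs_lt_card_visits {d m : ℕ} {f : ℕ → ℤ} (h : IsPath d m f) {i : ℕ}
    (hi : i ≤ m + 1) : |f i| < (visits m f).card := by
  rcases le_total 0 (f i) with h0 | h0
  · have h1 : Finset.Icc 0 (f i) ⊆ visits m f := fun v hv =>
      h.visits_between hi (Or.inl (Finset.mem_Icc.1 hv))
    have h2 := Finset.card_le_card h1
    rw [Int.card_Icc] at h2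
    rw [abs_of_nonneg h0]; omega
  · have h1 : Finset.Icc (f i) 0 ⊆ visits m f := fun v hv =>
      h.visits_between hi (Or.inr (Finset.mem_Icc.1 hv))
    have h2 := Finset.card_le_card h1
    rw [Int.card_Icc] at h2
    rw [abs_of_nonpos h0]; omega

theorem IsPath.two_le_card_visits {d m : ℕ} {f : ℕ → ℤ} (h : IsPath d m f) :
    2 ≤ (visits m f).card := by
  have h1 := h.step
  have h2 := h.hom 0 1 (by omega) (by omega) (by omega) (by omega)
  have h3 := h.abs_lt_card_visits (i := 1) (by omega)
  rw [h.zero, sub_zero] at h2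
  omega

theorem prob_two_valued_le {d : ℕ} (hd : 1 ≤ d) (m : ℕ) :
    (lineLaw (m + 1) d).real {f | rangeSize f < 3} ≤ (2 : ℝ) ^ (1 - ((m + 1 : ℕ) : ℝ) / 2) := by
  obtain ⟨lam, h⟩ := exists_isRate hd
  simp only [rangeSize_eq_card_visits]
  rw [real_lineLaw d m fun g => (visits m g).card < 3]
  have hpos : (0 : ℝ) < (paths d m).card := by exact_mod_cast card_paths_pos d m
  rw [div_le_iff₀ hpos]
  have h1 : (2 : ℝ) ^ ((m : ℝ) / 2) ≤ lam ^ m := by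
    have h2 : (2 : ℝ) ^ ((1 : ℝ) / 2) ≤ lam := by
      rw [← Real.sqrt_eq_rpow]
      exact Real.sqrt_le_iff.2 ⟨h.pos.le, h.two_le_sq⟩
    calc (2 : ℝ) ^ ((m : ℝ) / 2) = ((2 : ℝ) ^ ((1 : ℝ) / 2)) ^ m := by
          rw [← Real.rpow_natCast, ← Real.rpow_mul (by norm_num)]; ring_nf
      _ ≤ lam ^ m := pow_le_pow_left₀ (by positivity) h2 m
  have h3 : 1 ≤ (2 : ℝ) ^ (1 - ((m + 1 : ℕ) : ℝ) / 2) * 2 ^ ((m : ℝ) / 2) := by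
    rw [← Real.rpow_add (by norm_num)]
    refine Real.one_le_rpow (by norm_num) ?_
    push_cast
    linarith
  have h4 : 0 < (2 : ℝ) ^ (1 - ((m + 1 : ℕ) : ℝ) / 2) := by positivity
  calc _ ≤ (2 : ℝ) := card_two_valued_le d m
    _ ≤ 2 * ((2 : ℝ) ^ (1 - ((m + 1 : ℕ) : ℝ) / 2) * 2 ^ ((m : ℝ) / 2)) := by linarith
    _ ≤ 2 * ((2 : ℝ) ^ (1 - ((m + 1 : ℕ) : ℝ) / 2) * lam ^ m) := by gcongr
    _ = (2 : ℝ) ^ (1 - ((m + 1 : ℕ) : ℝ) / 2) * (2 * lam ^ m) := by ring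
    _ ≤ _ := by gcongr; exact h.two_mul_pow_le_card m

/-- A range of at most `R + 1` values confines the path to `[-R, R]`, since the values `0, …, f i`
are all taken. -/
theorem prob_small_range_le {d : ℕ} (hd : 1 ≤ d) {m : ℕ} (hm : 1 ≤ m) (R : ℕ) :
    (lineLaw (m + 1) d).real {f | rangeSize f ≤ R + 1} ≤
      6 * Real.exp (-(scale (m + 1) d / (320 * (R + 1) ^ 2))) := by
  obtain ⟨lam, h⟩ := exists_isRate hd
  simp only [rangeSize_eq_card_visits]
  rw [real_lineLaw d m fun g => (visits m g).card ≤ R + 1]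
  have hpos : (0 : ℝ) < (paths d m).card := by exact_mod_cast card_paths_pos d m
  rw [div_le_iff₀ hpos]
  have h1 : ((paths d m).filter fun g => (visits m g).card ≤ R + 1).card ≤
      ((paths d m).filter fun f => ∀ i ≤ m + 1, |f i| ≤ (R : ℤ)).card := by
    refine Finset.card_le_card fun f hf => ?_
    simp only [Finset.mem_filter] at hf ⊢
    refine ⟨hf.1, fun i hi => ?_⟩
    have := (mem_paths.1 hf.1).abs_lt_card_visits hi
    omega
  refine (Nat.cast_le.2 h1).trans ((h.card_confined_le hd R m).trans ?_)
  have h2 : scale (m + 1) d / (320 * (R + 1) ^ 2) ≤ m * decay d lam / (40 * (R + 1) ^ 2) := by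
    have := h.scale_le_mul_decay hm
    rw [div_le_div_iff₀ (by positivity) (by positivity)]
    have h3 : (0 : ℝ) ≤ (R + 1) ^ 2 := by positivity
    nlinarith
  gcongr

/-- The range is large with high probability. -/
theorem exists_prob_range_lt_le {ε : ℝ} (hε : 0 < ε) :
    ∃ δ : ℝ, 0 < δ ∧ ∀ n d : ℕ, 1 ≤ n → 1 ≤ d →
      (lineLaw n d).real {f | (rangeSize f : ℤ) < 3 + ⌊δ * √(scale n d)⌋} ≤
        ε + (2 : ℝ) ^ (1 - (n : ℝ) / 2) := by
  -- the bound `6 * exp (-1 / (2880 * δ ^ 2))` below is at most `17280 * δ ^ 2`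
  set δ := min 1 (ε / 17280) with hδ
  have hδ0 : 0 < δ := lt_min one_pos (by positivity)
  have hδ1 : δ ≤ 1 := min_le_left _ _
  have hδ2 : 17280 * δ ^ 2 ≤ ε := by
    have : δ ≤ ε / 17280 := min_le_right _ _
    nlinarith
  refine ⟨δ, hδ0, fun n d hn hd => ?_⟩
  obtain ⟨m, rfl⟩ : ∃ m, n = m + 1 := ⟨n - 1, by omega⟩
  set s := √(scale (m + 1) d) with hs
  have hs0 : 0 ≤ s := Real.sqrt_nonneg _
  have hssq : s ^ 2 = scale (m + 1) d := Real.sq_sqrt (scale_nonneg _ _)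
  rcases lt_or_ge ⌊δ * s⌋ 1 with hfl | hfl
  · have h0 : ⌊δ * s⌋ = 0 := by
      have : 0 ≤ ⌊δ * s⌋ := Int.floor_nonneg.2 (by positivity)
      omega
    have h1 : {f : Fin (m + 1 + 1) → ℤ | (rangeSize f : ℤ) < 3 + ⌊δ * s⌋} =
        {f | rangeSize f < 3} := by
      ext f
      rw [h0]
      simp only [Set.mem_ofPred_eq]
      omega
    rw [h1]
    exact (prob_two_valued_le hd m).trans (le_add_of_nonneg_left hε.le)
  · have hfl' : 1 ≤ δ * s := by
      have := Int.le_floor.1 hfl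
      simpa using this
    have hs1 : 1 ≤ s := by nlinarith
    have hm := two_le_of_one_le_scale hd (show 1 ≤ scale (m + 1) d by rw [← hssq]; nlinarith)
    set R := ⌊δ * s⌋.toNat + 1 with hR
    have hRle : ((R : ℝ) + 1) ≤ 3 * (δ * s) := by
      have h1 : ((⌊δ * s⌋.toNat : ℕ) : ℝ) = (⌊δ * s⌋ : ℝ) := by
        have : ((⌊δ * s⌋.toNat : ℕ) : ℤ) = ⌊δ * s⌋ := Int.toNat_of_nonneg (by omega)
        exact_mod_cast this
      have h2 := Int.floor_le (δ * s)
      rw [hR]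
      push_cast
      rw [h1]
      linarith
    have hsub : {f : Fin (m + 1 + 1) → ℤ | (rangeSize f : ℤ) < 3 + ⌊δ * s⌋} ⊆
        {f | rangeSize f ≤ R + 1} := by
      intro f hf
      simp only [Set.mem_ofPred_eq] at hf ⊢
      omega
    have hy : 1 / (2880 * δ ^ 2) ≤ scale (m + 1) d / (320 * (R + 1) ^ 2) := by
      have h1 : ((R : ℝ) + 1) ^ 2 ≤ (3 * (δ * s)) ^ 2 := pow_le_pow_left₀ (by positivity) hRle 2
      rw [← hssq, div_le_div_iff₀ (by positivity) (by positivity)]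
      nlinarith
    have hexp : Real.exp (-(scale (m + 1) d / (320 * (R + 1) ^ 2))) ≤ 2880 * δ ^ 2 := by
      rw [Real.exp_neg]
      have h1 : 1 / (2880 * δ ^ 2) ≤ Real.exp (scale (m + 1) d / (320 * (R + 1) ^ 2)) := by
        linarith [Real.add_one_le_exp (scale (m + 1) d / (320 * (R + 1) ^ 2))]
      have h2 := inv_anti₀ (by positivity) h1
      simpa using h2
    have h3 : 0 < (2 : ℝ) ^ (1 - ((m + 1 : ℕ) : ℝ) / 2) := by positivity
    calc _ ≤ (lineLaw (m + 1) d).real {f | rangeSize f ≤ R + 1} := measureReal_mono hsub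
      _ ≤ 6 * Real.exp (-(scale (m + 1) d / (320 * (R + 1) ^ 2))) :=
          prob_small_range_le hd (by omega) R
      _ ≤ 6 * (2880 * δ ^ 2) := by gcongr
      _ ≤ _ := by linarith

/-! ### The mean of the range -/

theorem integral_rangeSize_eq (d m : ℕ) :
    ∫ f, (rangeSize f : ℝ) ∂(lineLaw (m + 1) d) =
      (∑ g ∈ paths d m, ((visits m g).card : ℝ)) / (paths d m).card := by
  simp only [rangeSize_eq_card_visits]
  exact integral_lineLaw d m fun g => ((visits m g).card : ℝ)

theorem integral_rangeSize_le {n d : ℕ} (hn : 1 ≤ n) (hd : 1 ≤ d) :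
    ∫ f, (rangeSize f : ℝ) ∂(lineLaw n d) ≤ 3 + 50000 * √(scale n d) := by
  obtain ⟨m, rfl⟩ : ∃ m, n = m + 1 := ⟨n - 1, by omega⟩
  obtain ⟨lam, h⟩ := exists_isRate hd
  have hpos : (0 : ℝ) < (paths d m).card := by exact_mod_cast card_paths_pos d m
  have hmd := h.mul_decay_le_scale m
  set s := √(scale (m + 1) d) with hs
  have hs0 : 0 ≤ s := Real.sqrt_nonneg _
  have hssq : s ^ 2 = scale (m + 1) d := Real.sq_sqrt (scale_nonneg _ _)
  rw [← hssq] at hmd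
  rw [integral_rangeSize_eq, div_le_iff₀' hpos]
  rcases le_or_gt s 1 with hs1 | hs1
  -- for a small scale few flips are at odd distance from their predecessor; for a large scale the
  -- range is that of a diffusion, and `r = 1 / s` balances the two factors of the bound
  · refine (sum_card_visits_le h m).trans (mul_le_mul_of_nonneg_left ?_ hpos.le)
    nlinarith
  · refine (h.sum_card_visits_le_div hd (r := 1 / s) (by positivity)
      (by rw [div_le_one (by linarith)]; exact hs1.le) m).trans
      (mul_le_mul_of_nonneg_left ?_ hpos.le)
    have h1 : m * decay d lam * (1 / s) ^ 2 ≤ 2 := by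
      rw [div_pow, one_pow, mul_one_div, div_le_iff₀ (by positivity)]
      nlinarith
    have h2 : Real.exp (m * decay d lam * (1 / s) ^ 2) ≤ 9 := by
      refine (Real.exp_le_exp.2 h1).trans ?_
      rw [show (2 : ℝ) = 1 + 1 by norm_num, Real.exp_add]
      nlinarith [Real.exp_one_lt_d9, Real.exp_pos 1]
    rw [div_div_eq_mul_div, div_one]
    nlinarith

/-- The range has at least two values, and at least `a` outside the event `rangeSize f < a`. -/
theorem le_integral_rangeSize {n d : ℕ} (hn : 1 ≤ n) (a : ℝ) :
    2 + (a - 2) * (1 - (lineLaw n d).real {f | (rangeSize f : ℝ) < a}) ≤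
      ∫ f, (rangeSize f : ℝ) ∂(lineLaw n d) := by
  obtain ⟨m, rfl⟩ : ∃ m, n = m + 1 := ⟨n - 1, by omega⟩
  have hpos : (0 : ℝ) < (paths d m).card := by exact_mod_cast card_paths_pos d m
  rw [integral_rangeSize_eq, le_div_iff₀ hpos]
  simp only [rangeSize_eq_card_visits]
  rw [real_lineLaw d m fun g => ((visits m g).card : ℝ) < a]
  calc _ = ∑ g ∈ paths d m, (a - (a - 2) * if ((visits m g).card : ℝ) < a then 1 else 0) := by
        rw [Finset.sum_sub_distrib, ← Finset.mul_sum, ← Finset.natCast_card_filter,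
          Finset.sum_const, nsmul_eq_mul]
        field_simp
        ring
    _ ≤ _ := by
        refine Finset.sum_le_sum fun g hg => ?_
        have h2 : (2 : ℝ) ≤ (visits m g).card := by
          exact_mod_cast (mem_paths.1 hg).two_le_card_visits
        split_ifs with h3
        · linarith
        · linarith

theorem exists_le_integral_rangeSize :
    ∃ c : ℝ, 0 < c ∧ ∀ n d : ℕ, 1 ≤ n → 1 ≤ d →
      3 + (⌊c * √(scale n d)⌋ : ℝ) - (2 : ℝ) ^ (1 - (n : ℝ) / 2) ≤
        ∫ f, (rangeSize f : ℝ) ∂(lineLaw n d) := by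
  obtain ⟨δ, hδ0, hδ⟩ := exists_prob_range_lt_le (ε := 1 / 4) (by norm_num)
  set c := min (1 / 4) (δ / 8) with hc
  have hc0 : 0 < c := lt_min (by norm_num) (by positivity)
  have hc1 : c ≤ 1 / 4 := min_le_left _ _
  have hc2 : c ≤ δ / 8 := min_le_right _ _
  refine ⟨c, hc0, fun n d hn hd => ?_⟩
  set s := √(scale n d) with hs
  have hs0 : 0 ≤ s := Real.sqrt_nonneg _
  have hssq : s ^ 2 = scale n d := Real.sq_sqrt (scale_nonneg _ _)
  rcases lt_or_ge ⌊c * s⌋ 1 with hfl | hfl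
  · have h0 : ⌊c * s⌋ = 0 := by
      have : 0 ≤ ⌊c * s⌋ := Int.floor_nonneg.2 (by positivity)
      omega
    obtain ⟨m, rfl⟩ : ∃ m, n = m + 1 := ⟨n - 1, by omega⟩
    have h1 := le_integral_rangeSize (d := d) hn 3
    have h2 := prob_two_valued_le hd m
    have h3 : {f : Fin (m + 1 + 1) → ℤ | (rangeSize f : ℝ) < 3} = {f | rangeSize f < 3} := by
      ext f
      simp only [Set.mem_ofPred_eq]
      norm_cast
    rw [h3] at h1
    rw [h0]
    push_cast at h2 ⊢
    linarith
  · have hcs : (1 : ℝ) ≤ (⌊c * s⌋ : ℝ) := by exact_mod_cast hfl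
    have hcs' := Int.floor_le (c * s)
    have hδs : 8 * (⌊c * s⌋ : ℝ) ≤ (⌊δ * s⌋ : ℝ) := by
      have : 8 * ⌊c * s⌋ ≤ ⌊δ * s⌋ := by
        rw [Int.le_floor]
        push_cast
        nlinarith
      exact_mod_cast this
    have hs4 : 4 ≤ s := by nlinarith
    -- here `n` is so large that the exceptional term is at most `1 / 4`
    have hn16 : (16 : ℝ) ≤ n := by
      have h1 : 16 ≤ scale n d := by rw [← hssq]; nlinarith
      rw [scale_eq, le_div_iff₀ (by positivity)] at h1
      have : (1 : ℝ) ≤ 2 ^ d := one_le_pow₀ (by norm_num)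
      linarith
    have htwo : (2 : ℝ) ^ (1 - (n : ℝ) / 2) ≤ 1 / 4 := by
      calc (2 : ℝ) ^ (1 - (n : ℝ) / 2) ≤ (2 : ℝ) ^ (-2 : ℝ) :=
            Real.rpow_le_rpow_of_exponent_le (by norm_num) (by linarith)
        _ = 1 / 4 := by
            rw [Real.rpow_neg (by norm_num), show (2 : ℝ) = ((2 : ℕ) : ℝ) by norm_num,
              Real.rpow_natCast]
            norm_num
    have h1 := le_integral_rangeSize (d := d) hn (3 + ⌊δ * s⌋)
    have h2 := hδ n d hn hd
    have h3 : {f : Fin (n + 1) → ℤ | (rangeSize f : ℝ) < 3 + ⌊δ * s⌋} =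
        {f | (rangeSize f : ℤ) < 3 + ⌊δ * s⌋} := by
      ext f
      simp only [Set.mem_ofPred_eq]
      norm_cast
    rw [h3] at h1
    have h4 : 0 < (2 : ℝ) ^ (1 - (n : ℝ) / 2) := by positivity
    nlinarith

/-! ### The subcritical regime -/

theorem tendsto_scale {d : ℕ → ℕ}
    (h : Tendsto (fun n : ℕ => (d n : ℝ) - Real.logb 2 (n : ℝ)) atTop atBot) :
    Tendsto (fun n => scale n (d n)) atTop atTop := by
  have h1 : Tendsto (fun n : ℕ => (2 : ℝ) ^ (-((d n : ℝ) - Real.logb 2 (n : ℝ)))) atTop atTop :=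
    (tendsto_rpow_atTop_of_base_gt_one 2 (by norm_num)).comp (tendsto_neg_atBot_atTop.comp h)
  refine h1.congr' ?_
  filter_upwards [eventually_ge_atTop 1] with n hn
  have hn' : (0 : ℝ) < n := by exact_mod_cast hn
  rw [neg_sub, sub_eq_add_neg, Real.rpow_add (by norm_num),
    Real.rpow_logb (by norm_num) (by norm_num) hn', scale]

theorem tendsto_two_rpow :
    Tendsto (fun n : ℕ => (2 : ℝ) ^ (1 - (n : ℝ) / 2)) atTop (𝓝 0) := by
  refine (tendsto_rpow_atBot_of_base_gt_one 2 (by norm_num)).comp ?_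
  refine tendsto_atBot_add_const_left _ 1 ?_
  exact tendsto_neg_atTop_atBot.comp (tendsto_natCast_atTop_atTop.atTop_div_const (by norm_num))

theorem tendsto_prob_rangeSize_le {d : ℕ → ℕ} (hd : ∀ n, 1 ≤ n → 1 ≤ d n)
    (h : Tendsto (fun n : ℕ => (d n : ℝ) - Real.logb 2 (n : ℝ)) atTop atBot) (r : ℕ) :
    Tendsto (fun n : ℕ => (lineLaw n (d n)).real {f | rangeSize f ≤ r}) atTop (𝓝 0) := by
  rw [Metric.tendsto_atTop']
  intro η hη
  obtain ⟨δ, hδ0, hδ⟩ := exists_prob_range_lt_le (ε := η / 2) (by linarith)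
  have h1 : ∀ᶠ n in atTop, (r : ℝ) / δ ≤ √(scale n (d n)) :=
    (Real.tendsto_sqrt_atTop.comp (tendsto_scale h)).eventually_ge_atTop _
  have h2 : ∀ᶠ n : ℕ in atTop, (2 : ℝ) ^ (1 - (n : ℝ) / 2) < η / 2 :=
    tendsto_two_rpow.eventually_lt_const (by linarith)
  obtain ⟨N, hN⟩ := eventually_atTop.1 (h1.and (h2.and (eventually_ge_atTop 1)))
  refine ⟨N, fun n hn => ?_⟩
  obtain ⟨h3, h4, h5⟩ := hN n hn.le
  rw [Real.dist_eq, sub_zero, abs_of_nonneg measureReal_nonneg]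
  have hsub : {f : Fin (n + 1) → ℤ | rangeSize f ≤ r} ⊆
      {f | (rangeSize f : ℤ) < 3 + ⌊δ * √(scale n (d n))⌋} := by
    intro f hf
    have h6 : (r : ℤ) ≤ ⌊δ * √(scale n (d n))⌋ := by
      rw [Int.le_floor]
      rw [div_le_iff₀ hδ0] at h3
      push_cast
      linarith
    simp only [Set.mem_ofPred_eq] at hf ⊢
    omega
  have h7 := (measureReal_mono hsub).trans (hδ n (d n) h5 (hd n h5))
  linarith

end LineHom

theorem theorem2p3 :
    -- bounds on the expected size of the range
    (∃ C c : ℝ, 0 < C ∧ 0 < c ∧ ∀ n d : ℕ, 1 ≤ n → 1 ≤ d →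
      3 + (⌊c * √((n : ℝ) * (2 : ℝ) ^ (-(d : ℝ)))⌋ : ℝ) - (2 : ℝ) ^ (1 - (n : ℝ) / 2)
          ≤ ∫ f, (LineHom.rangeSize f : ℝ) ∂(LineHom.lineLaw n d) ∧
        ∫ f, (LineHom.rangeSize f : ℝ) ∂(LineHom.lineLaw n d)
          ≤ 3 + C * √((n : ℝ) * (2 : ℝ) ^ (-(d : ℝ)))) ∧
    -- the range is large with high probability
    (∀ ε : ℝ, 0 < ε → ∃ δ : ℝ, 0 < δ ∧ ∀ n d : ℕ, 1 ≤ n → 1 ≤ d →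
      (LineHom.lineLaw n d).real
          {f | (LineHom.rangeSize f : ℤ) < 3 + ⌊δ * √((n : ℝ) * (2 : ℝ) ^ (-(d : ℝ)))⌋}
        ≤ ε + (2 : ℝ) ^ (1 - (n : ℝ) / 2)) ∧
    -- in the subcritical regime the range tends to infinity in probability
    (∀ d : ℕ → ℕ, (∀ n, 1 ≤ n → 1 ≤ d n) →
      Tendsto (fun n : ℕ => (d n : ℝ) - Real.logb 2 (n : ℝ)) atTop atBot →
      ∀ r : ℕ, 1 ≤ r →
        Tendsto (fun n : ℕ => (LineHom.lineLaw n (d n)).real {f | LineHom.rangeSize f ≤ r})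
          atTop (𝓝 0)) := by
  obtain ⟨c, hc0, hc⟩ := LineHom.exists_le_integral_rangeSize
  exact ⟨⟨50000, c, by norm_num, hc0, fun n d hn hd =>
      ⟨hc n d hn hd, LineHom.integral_rangeSize_le hn hd⟩⟩,
    fun ε hε => LineHom.exists_prob_range_lt_le hε,
    fun d hd h r _ => LineHom.tendsto_prob_rangeSize_le hd h r⟩
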